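/- **Theorem 2 (Limit reconstruction for time-continuous scanning paths).** Let $T,\alpha,D>0$, $\mu\in\mathbb R$, $w_0\in\mathbb R^2$. Let $A\subset\mathbb R^P$ be compact and nonempty, and let $p\mapsto\rho[p]$ be continuous from $A$ into $C^{0,1}(\mathbb R^2)$ (bounded Lipschitz functions), where each $\rho[p]$, $p\in A$, is bounded below by a positive constant. For $n\in\mathbb N$ let $N^n\ge1$ with $N^n\to\infty$, $\Delta t^n=T/N^n$, $t^n_i=i\,\Delta t^n$, $x^n_1,\dots,x^n_{N^n}\in\mathbb R^2$, $x^n(t)=x^n_i$ for $t\in[t^n_{i-1},t^n_i)$, and $\sigma^n>0$. Suppose that $x^n\to x^\infty$ uniformly on $[0,T)$ with $x^\infty:[0,T]\to\mathbb R^2$ continuous, and $\sigma^nN^n/\alpha\to0$. *Data.* Let $\rho^\dagger:\mathbb R^2\to[0,\infty)$ (the true density) and $w:[0,T]\to\mathbb R^2$ (the realized sample motion) be continuous, and put $\lambda^n(t)=\rho^\dagger(x^n(t)+w(t))$, $\lambda^\infty(t)=\rho^\dagger(x^\infty(t)+w(t))$. Let $\hat e$ be a Poisson point process of unit intensity on $[0,T]\times[0,\infty)$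 and $(r(t))_{t\in[0,T]}$ a family of independent standard normal random variables. For $\lambda:[0,T]\to[0,\infty)$ let $\hat e_\lambda=\sum\delta_\tau$, the sum running over the points $(\tau,l)$ of $\hat e$ with $l\le\lambda(\tau)$; put $e^n=\hat e_{\lambda^n}$, $e^\infty=\hat e_{\lambda^\infty}$, and $$g^n_i=\alpha\,e^n([t^n_{i-1},t^n_i))+\mu+\sigma^n r(t^n_i),\qquad \mathcal G^n(t)=\frac{g^n_i-\mu}{\alpha\Delta t^n}\ \text{ for } t\in[t^n_{i-1},t^n_i).$$ *Energies.* Let $$d^n(g,z)=-\log\sum_{k=0}^\infty\frac{z^ke^{-z}}{k!}\,\frac{1}{\sqrt{2\pi}\,\sigma^n}\exp\Big(-\frac{(g-\alpha k-\mu)^2}{2(\sigma^n)^2}\Big),$$ and let $\iota_A$ be $0$ on $A$ and $\infty$ elsewhere. For $\mathcal W\in H^1((0,T))^2$ (identified with its continuous representative) and $p\in\mathbb R^P$ let $$\mathcal E^n[\mathcal W,p]=\sum_{i=1}^{N^n}d^n\big(g^n_i,\Delta t^n\rho[p](x^n_i+\mathcal W(t^n_i))\big)+\frac1{2D}\sum_{i=1}^{N^n}\frac{|\mathcal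 W(t^n_i)-\mathcal W(t^n_{i-1})|^2}{\Delta t^n}+\iota_A(p)$$ if $\mathcal W(0)=w_0$ and $\mathcal W$ is the piecewise affine interpolation of its values at $t^n_0,\dots,t^n_{N^n}$, and $\mathcal E^n[\mathcal W,p]=\infty$ otherwise. Let $$\mathcal E^\infty[\mathcal W,p]=\int_0^T u\,dt-\int_{[0,T]}\log u\,de^\infty+\frac1{2D}\int_0^T|\mathcal W'|^2\,dt+\iota_A(p),\qquad u(t)=\rho[p](x^\infty(t)+\mathcal W(t)),$$ if $\mathcal W(0)=w_0$, and $\mathcal E^\infty[\mathcal W,p]=\infty$ otherwise. *Claim.* There are real constants $C^n=C^n(\mathcal G^n,\sigma^n)$, depending (for given $T$, $\alpha$ and $N^n$) only on $\mathcal G^n$ and $\sigma^n$, such that almost surely with respect to $\hat e$ and $r$ the following hold. 1. $\Gamma\text{-}\lim_{n\to\infty}(\mathcal E^n-C^n)=\mathcal E^\infty$ with respect to weak convergence in $H^1((0,T))^2$ and convergence in $\mathbb R^P$: whenever $(\mathcal W^n,p^n)\to(\mathcal W,p)$ in this sense, $\mathcal E^\infty[\mathcal W,p]\le\liminf_n(\mathcal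 E^n[\mathcal W^n,p^n]-C^n)$, and every $(\mathcal W,p)$ is the limit of a sequence with $\limsup_n(\mathcal E^n[\mathcal W^n,p^n]-C^n)\le\mathcal E^\infty[\mathcal W,p]$. 2. If $(\mathcal W^n,p^n)$ minimizes $\mathcal E^n$ for every $n$, then every subsequence of $((\mathcal W^n,p^n))_n$ has a further subsequence that converges in the same topology to a minimizer of $\mathcal E^\infty$. -/

import Mathlib

open MeasureTheory Set Filter Topology

section SobolevSpace

open scoped ContDiff

/-- The plane `ℝ²` with its Euclidean norm. -/
abbrev Plane : Type := EuclideanSpace ℝ (Fin 2)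

/-- Lebesgue measure on the open time interval `(0,T)`. -/
noncomputable abbrev timeMeasure (T : ℝ) : Measure ℝ := volume.restrict (Ioo 0 T)

/-- `V` is the weak derivative of `W` on `(0,T)`: integration by parts holds against every smooth
test function with compact support in `(0,T)`. -/
def HasWeakDeriv (T : ℝ) (W V : ℝ → Plane) : Prop :=
  ∀ φ : ℝ → ℝ, ContDiff ℝ ∞ φ → HasCompactSupport φ → tsupport φ ⊆ Ioo 0 T →
    ∫ t, deriv φ t • W t ∂(timeMeasure T) = -∫ t, φ t • V t ∂(timeMeasure T)

theorem integrable_smul_of_compactSupport {T : ℝ} {φ : ℝ → ℝ} (hφ : Continuous φ)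
    (hc : HasCompactSupport φ) (f : Lp Plane 2 (timeMeasure T)) :
    Integrable (fun t => φ t • f t) (timeMeasure T) := by
  obtain ⟨C, hC⟩ := hφ.bounded_above_of_compact_support hc
  exact ((Lp.memLp f).integrable (by norm_num)).bdd_smul C hφ.aestronglyMeasurable
    (Eventually.of_forall hC)

/-- The Sobolev space `H¹((0,T))²`: an element is an `L²` function together with its (unique)
weak derivative, which is again in `L²`; norm and inner product are those of `L² × L²`, that is,
`‖W‖² = ‖W‖²_{L²} + ‖W'‖²_{L²}`. -/
noncomputable def H1 (T : ℝ) :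
    Submodule ℝ (WithLp 2 (Lp Plane 2 (timeMeasure T) × Lp Plane 2 (timeMeasure T))) where
  carrier := {w | HasWeakDeriv T w.fst w.snd}
  zero_mem' := by
    intro φ _ _ _
    have h : (⇑(0 : Lp Plane 2 (timeMeasure T))) =ᵐ[timeMeasure T] 0 := Lp.coeFn_zero _ _ _
    rw [integral_eq_zero_of_ae (μ := timeMeasure T), integral_eq_zero_of_ae (μ := timeMeasure T),
      neg_zero]
    · filter_upwards [h] with t ht
      rw [WithLp.zero_snd, ht, Pi.zero_apply, smul_zero]
    · filter_upwards [h] with t ht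
      rw [WithLp.zero_fst, ht, Pi.zero_apply, smul_zero]
  add_mem' := by
    intro a b ha hb φ h1 h2 h3
    have hd : Continuous (deriv φ) := h1.continuous_deriv (by simp)
    have e1 : ∫ t, deriv φ t • (a + b).fst t ∂(timeMeasure T)
        = ∫ t, (deriv φ t • a.fst t + deriv φ t • b.fst t) ∂(timeMeasure T) := by
      apply integral_congr_ae
      filter_upwards [Lp.coeFn_add a.fst b.fst] with t ht
      rw [WithLp.add_fst, ht, Pi.add_apply, smul_add]
    have e2 : ∫ t, φ t • (a + b).snd t ∂(timeMeasure T)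
        = ∫ t, (φ t • a.snd t + φ t • b.snd t) ∂(timeMeasure T) := by
      apply integral_congr_ae
      filter_upwards [Lp.coeFn_add a.snd b.snd] with t ht
      rw [WithLp.add_snd, ht, Pi.add_apply, smul_add]
    rw [e1, e2, integral_add (integrable_smul_of_compactSupport hd h2.deriv _)
      (integrable_smul_of_compactSupport hd h2.deriv _),
      integral_add (integrable_smul_of_compactSupport h1.continuous h2 _)
      (integrable_smul_of_compactSupport h1.continuous h2 _), ha φ h1 h2 h3, hb φ h1 h2 h3]
    abel
  smul_mem' := by
    intro c a ha φ h1 h2 h3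
    have e1 : ∫ t, deriv φ t • (c • a).fst t ∂(timeMeasure T)
        = ∫ t, c • (deriv φ t • a.fst t) ∂(timeMeasure T) := by
      apply integral_congr_ae
      filter_upwards [Lp.coeFn_smul c a.fst] with t ht
      simp [ht, smul_comm c]
    have e2 : ∫ t, φ t • (c • a).snd t ∂(timeMeasure T)
        = ∫ t, c • (φ t • a.snd t) ∂(timeMeasure T) := by
      apply integral_congr_ae
      filter_upwards [Lp.coeFn_smul c a.snd] with t ht
      simp [ht, smul_comm c]
    rw [e1, e2, integral_smul, integral_smul, ha φ h1 h2 h3, smul_neg]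

/-- A scalar integrable function with an integrable weak derivative agrees almost everywhere with
a constant plus the indefinite integral of that derivative. -/
theorem ae_eq_const_add_integral_of_weakDeriv {T : ℝ} (hT : 0 < T) {f g : ℝ → ℝ}
    (hf : Integrable f (timeMeasure T)) (hg : Integrable g (timeMeasure T))
    (h : ∀ φ : ℝ → ℝ, ContDiff ℝ ∞ φ → HasCompactSupport φ → tsupport φ ⊆ Ioo 0 T →
      ∫ t, deriv φ t * f t ∂(timeMeasure T) = -∫ t, φ t * g t ∂(timeMeasure T)) :
    ∃ c : ℝ, ∀ᵐ t ∂(timeMeasure T), f t = c + ∫ s in (0 : ℝ)..t, g s := by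
  have hgi : IntervalIntegrable g volume 0 T := by
    rw [intervalIntegrable_iff_integrableOn_Ioo_of_le hT.le]; exact hg
  set F : ℝ → ℝ := fun t => ∫ s in (0 : ℝ)..t, g s with hF
  have hFac : AbsolutelyContinuousOnInterval F 0 T :=
    hgi.absolutelyContinuousOnInterval_intervalIntegral left_mem_uIcc
  have hFi : Integrable F (timeMeasure T) := by
    have : IntervalIntegrable F volume 0 T := hFac.continuousOn.intervalIntegrable
    rwa [intervalIntegrable_iff_integrableOn_Ioo_of_le hT.le] at this
  have conv : ∀ u : ℝ → ℝ, ∫ t, u t ∂(timeMeasure T) = ∫ t in (0 : ℝ)..T, u t := by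
    intro u
    rw [intervalIntegral.integral_of_le hT.le, integral_Ioc_eq_integral_Ioo]
  have dF : ∀ᵐ t ∂(timeMeasure T), deriv F t = g t := by
    rw [ae_restrict_iff' measurableSet_Ioo]
    filter_upwards [hgi.ae_hasDerivAt_integral] with t ht hmem
    have hu : uIcc 0 T = Icc 0 T := uIcc_of_le hT.le
    exact (ht (hu ▸ Ioo_subset_Icc_self hmem) 0 (by simp)).deriv
  -- integration by parts for `F`
  have ibp : ∀ φ : ℝ → ℝ, ContDiff ℝ ∞ φ → HasCompactSupport φ → tsupport φ ⊆ Ioo 0 T →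
      ∫ t, deriv φ t * F t ∂(timeMeasure T) = -∫ t, φ t * g t ∂(timeMeasure T) := by
    intro φ h1 h2 h3
    have hφac : AbsolutelyContinuousOnInterval φ 0 T :=
      (h1.of_le (by simp)).contDiffOn.absolutelyContinuousOnInterval
    have h0 : φ 0 = 0 := by
      by_contra hne
      exact absurd (h3 (subset_tsupport _ hne)).1 (lt_irrefl _)
    have hT0 : φ T = 0 := by
      by_contra hne
      exact absurd (h3 (subset_tsupport _ hne)).2 (lt_irrefl _)
    have := hφac.integral_mul_deriv_eq_deriv_mul hFac
    rw [h0, hT0, ← conv, ← conv] at this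
    have e : ∫ t, φ t * deriv F t ∂(timeMeasure T) = ∫ t, φ t * g t ∂(timeMeasure T) :=
      integral_congr_ae (by filter_upwards [dF] with t ht; rw [ht])
    rw [e] at this
    linarith
  -- a bump function of integral one
  obtain ⟨b, hbs⟩ : ∃ b : ContDiffBump (T / 2), Metric.closedBall (T / 2) b.rOut ⊆ Ioo 0 T := by
    refine ⟨⟨T / 8, T / 4, by positivity, by linarith⟩, ?_⟩
    intro t ht
    rw [Real.closedBall_eq_Icc] at ht
    constructor <;> linarith [ht.1, ht.2]
  set η : ℝ → ℝ := b.normed volume with hη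
  have ηs : ContDiff ℝ ∞ η := b.contDiff_normed
  have ηc : HasCompactSupport η := b.hasCompactSupport_normed
  have ηt : tsupport η ⊆ Ioo 0 T := by rw [hη, b.tsupport_normed_eq]; exact hbs
  have supp0 : ∀ u : ℝ → ℝ, tsupport u ⊆ Ioo 0 T → ∀ t, t ∉ Ioo 0 T → u t = 0 :=
    fun u hu t ht => image_eq_zero_of_notMem_tsupport fun h => ht (hu h)
  have full : ∀ u v : ℝ → ℝ, tsupport u ⊆ Ioo 0 T →
      ∫ t, u t * v t ∂(timeMeasure T) = ∫ t, u t * v t := by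
    intro u v hu
    exact setIntegral_eq_integral_of_forall_compl_eq_zero fun t ht => by simp [supp0 u hu t ht]
  have ηone : ∫ t, η t ∂(timeMeasure T) = 1 := by
    have := full η (fun _ => 1) ηt
    simp only [mul_one] at this
    rw [this]; exact b.integral_normed
  have ibd : ∀ (u v : ℝ → ℝ), Continuous u → HasCompactSupport u → Integrable v (timeMeasure T) →
      Integrable (fun t => u t * v t) (timeMeasure T) := by
    intro u v hu huc hv
    obtain ⟨C, hC⟩ := hu.bounded_above_of_compact_support huc
    exact hv.bdd_mul hu.aestronglyMeasurable (Eventually.of_forall hC)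
  set c : ℝ := ∫ t, η t * (f t - F t) ∂(timeMeasure T) with hc
  refine ⟨c, ?_⟩
  have hGi : Integrable (fun t => f t - F t) (timeMeasure T) := hf.sub hFi
  have hci : Integrable (fun _ : ℝ => c) (timeMeasure T) := integrable_const _
  have key : ∀ ψ : ℝ → ℝ, ContDiff ℝ ∞ ψ → HasCompactSupport ψ → tsupport ψ ⊆ Ioo 0 T →
      ∫ t, ψ t • (f t - F t - c) = 0 := by
    intro ψ h1 h2 h3
    set m : ℝ := ∫ t, ψ t ∂(timeMeasure T) with hm
    set θ : ℝ → ℝ := fun t => ψ t - m * η t with hθ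
    have θs : ContDiff ℝ ∞ θ := h1.sub (contDiff_const.mul ηs)
    have θt : tsupport θ ⊆ tsupport ψ ∪ tsupport η := by
      refine closure_minimal ?_ ((isClosed_tsupport _).union (isClosed_tsupport _))
      intro t ht
      by_contra hcon
      rw [mem_union, not_or] at hcon
      exact ht (by
        simp [hθ, image_eq_zero_of_notMem_tsupport hcon.1, image_eq_zero_of_notMem_tsupport hcon.2])
    have θt' : tsupport θ ⊆ Ioo 0 T := θt.trans (union_subset h3 ηt)
    have θc : HasCompactSupport θ :=
      (h2.isCompact.union ηc.isCompact).of_isClosed_subset (isClosed_tsupport _) θt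
    have ηi : Integrable η (timeMeasure T) :=
      (ηs.continuous.integrable_of_hasCompactSupport ηc).restrict
    have ψi : Integrable ψ (timeMeasure T) :=
      (h1.continuous.integrable_of_hasCompactSupport h2).restrict
    have θint : ∫ t, θ t ∂(timeMeasure T) = 0 := by
      rw [hθ, integral_sub ψi (ηi.const_mul m), integral_const_mul, ηone]
      simp [hm]
    -- the primitive of `θ` is a test function
    set φ : ℝ → ℝ := fun t => ∫ s in (0 : ℝ)..t, θ s with hφ
    have φd : ∀ t, HasDerivAt φ (θ t) t := fun t =>
      intervalIntegral.integral_hasDerivAt_right (θs.continuous.intervalIntegrable _ _)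
        (θs.continuous.stronglyMeasurableAtFilter _ _) θs.continuous.continuousAt
    have φde : deriv φ = θ := funext fun t => (φd t).deriv
    have φs : ContDiff ℝ ∞ φ := by
      rw [contDiff_infty_iff_deriv]
      exact ⟨fun t => (φd t).differentiableAt, by rw [φde]; exact θs⟩
    -- `θ` is supported in a compact interval `[p,q] ⊆ (0,T)`
    obtain ⟨p, q, hp, hpq, hq, hθpq⟩ : ∃ p q : ℝ, 0 < p ∧ p ≤ q ∧ q < T ∧ tsupport θ ⊆ Icc p q := by
      rcases (tsupport θ).eq_empty_or_nonempty with he | hne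
      · exact ⟨T / 2, T / 2, by linarith, le_rfl, by linarith, by simp [he]⟩
      · have hcpt : IsCompact (tsupport θ) := θc
        refine ⟨sInf (tsupport θ), sSup (tsupport θ), (θt' (hcpt.sInf_mem hne)).1, ?_,
          (θt' (hcpt.sSup_mem hne)).2, ?_⟩
        · exact (csInf_le hcpt.bddBelow (hcpt.sSup_mem hne))
        · exact fun t ht => ⟨csInf_le hcpt.bddBelow ht, le_csSup hcpt.bddAbove ht⟩
    have θ0 : ∀ t, t ∉ Icc p q → θ t = 0 :=
      fun t ht => image_eq_zero_of_notMem_tsupport fun h => ht (hθpq h)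
    have φ0 : ∀ t, t ∉ Icc p q → φ t = 0 := by
      intro t ht
      rcases lt_or_ge t p with htp | htp
      · rw [hφ]
        refine intervalIntegral.integral_zero_ae (Eventually.of_forall fun s hs => θ0 s ?_)
        intro hs'
        rcases mem_uIoc.1 hs with h' | h' <;> linarith [h'.1, h'.2, hs'.1]
      · have htq : q < t := by
          by_contra hh
          exact ht ⟨htp, not_lt.1 hh⟩
        have hsum : φ t = φ T + ∫ s in T..t, θ s :=
          (intervalIntegral.integral_add_adjacent_intervals
            (θs.continuous.intervalIntegrable _ _) (θs.continuous.intervalIntegrable _ _)).symm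
        have hφT : φ T = 0 := by rw [hφ]; simp only; rw [← conv]; exact θint
        rw [hsum, hφT, zero_add]
        refine intervalIntegral.integral_zero_ae (Eventually.of_forall fun s hs => θ0 s ?_)
        intro hs'
        rcases mem_uIoc.1 hs with h' | h' <;> linarith [h'.1, h'.2, hs'.2]
    have φt : tsupport φ ⊆ Icc p q :=
      closure_minimal (fun t ht => by by_contra hcon; exact ht (φ0 t hcon)) isClosed_Icc
    have φc : HasCompactSupport φ := isCompact_Icc.of_isClosed_subset (isClosed_tsupport _) φt
    have φt' : tsupport φ ⊆ Ioo 0 T :=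
      φt.trans fun t ht => ⟨hp.trans_le ht.1, ht.2.trans_lt hq⟩
    have e0 : ∫ t, θ t * (f t - F t) ∂(timeMeasure T) = 0 := by
      have a1 := h φ φs φc φt'
      have a2 := ibp φ φs φc φt'
      rw [φde] at a1 a2
      have : ∫ t, θ t * (f t - F t) ∂(timeMeasure T)
          = ∫ t, θ t * f t ∂(timeMeasure T) - ∫ t, θ t * F t ∂(timeMeasure T) := by
        rw [← integral_sub (ibd _ _ θs.continuous θc hf) (ibd _ _ θs.continuous θc hFi)]
        simp only [mul_sub]
      rw [this, a1, a2, sub_self]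
    have e1 : ∫ t, ψ t * (f t - F t) ∂(timeMeasure T) = m * c := by
      have : ∫ t, θ t * (f t - F t) ∂(timeMeasure T)
          = ∫ t, ψ t * (f t - F t) ∂(timeMeasure T) - m * c := by
        rw [hc, ← integral_const_mul, ← integral_sub (ibd _ _ h1.continuous h2 hGi)
          ((ibd _ _ ηs.continuous ηc hGi).const_mul m)]
        congr 1; ext t; simp only [hθ]; ring
      linarith
    have e2 : ∫ t, ψ t * (f t - F t - c) ∂(timeMeasure T) = 0 := by
      have : ∫ t, ψ t * (f t - F t - c) ∂(timeMeasure T)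
          = ∫ t, ψ t * (f t - F t) ∂(timeMeasure T) - ∫ t, ψ t * c ∂(timeMeasure T) := by
        rw [← integral_sub (ibd _ _ h1.continuous h2 hGi) (ψi.mul_const c)]
        simp only [mul_sub]
      rw [this, e1, integral_mul_const, ← hm, sub_self]
    simp only [smul_eq_mul]
    rw [← full ψ _ h3]
    exact e2
  have loc : LocallyIntegrableOn (fun t => f t - F t - c) (Ioo 0 T) volume :=
    IntegrableOn.locallyIntegrableOn (hGi.sub hci)
  have := isOpen_Ioo.ae_eq_zero_of_integral_contDiff_smul_eq_zero loc key
  rw [ae_restrict_iff' measurableSet_Ioo]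
  filter_upwards [this] with t ht hmem
  have := ht hmem
  simp only [hF] at this
  linarith

/-- Every element of `H¹((0,T))²` has a representative that is continuous on `[0,T]`. -/
theorem H1.exists_continuous_rep {T : ℝ} (W : H1 T) :
    ∃ f : ℝ → Plane, ContinuousOn f (Icc 0 T) ∧ f =ᵐ[timeMeasure T] W.1.fst := by
  rcases le_or_gt T 0 with hT | hT
  · refine ⟨0, continuousOn_const, ?_⟩
    simp [timeMeasure, Ioo_eq_empty (not_lt.2 hT), EventuallyEq]
  have hcoord : ∀ (f : Lp Plane 2 (timeMeasure T)) (j : Fin 2),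
      Integrable (fun t => f t j) (timeMeasure T) := fun f j =>
    (EuclideanSpace.proj (𝕜 := ℝ) j).integrable_comp ((Lp.memLp f).integrable (by norm_num))
  have hint : ∀ (u : ℝ → Plane) (j : Fin 2), Integrable u (timeMeasure T) →
      (∫ t, u t ∂(timeMeasure T)) j = ∫ t, u t j ∂(timeMeasure T) := fun u j hu =>
    (ContinuousLinearMap.integral_comp_comm
      (EuclideanSpace.proj j : Plane →L[ℝ] ℝ) hu).symm
  have hj : ∀ j : Fin 2, ∃ c : ℝ, ∀ᵐ t ∂(timeMeasure T),
      W.1.fst t j = c + ∫ s in (0 : ℝ)..t, W.1.snd s j := by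
    intro j
    refine ae_eq_const_add_integral_of_weakDeriv hT (hcoord _ j) (hcoord _ j) ?_
    intro φ h1 h2 h3
    have hw := congrArg (fun v : Plane => v j) (W.2 φ h1 h2 h3)
    have hd : Continuous (deriv φ) := h1.continuous_deriv (by simp)
    simp only [PiLp.neg_apply] at hw
    rw [hint _ j (integrable_smul_of_compactSupport hd h2.deriv _),
      hint _ j (integrable_smul_of_compactSupport h1.continuous h2 _)] at hw
    simpa using hw
  choose c hcj using hj
  refine ⟨fun t => WithLp.toLp 2 fun j => c j + ∫ s in (0 : ℝ)..t, W.1.snd s j, ?_, ?_⟩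
  · refine (PiLp.continuous_toLp 2 _).comp_continuousOn (continuousOn_pi.2 fun j => ?_)
    refine continuousOn_const.add ?_
    have hi : IntervalIntegrable (fun s => W.1.snd s j) volume 0 T := by
      rw [intervalIntegrable_iff_integrableOn_Ioo_of_le hT.le]; exact hcoord _ j
    have := (hi.absolutelyContinuousOnInterval_intervalIntegral left_mem_uIcc).continuousOn
    rwa [uIcc_of_le hT.le] at this
  · filter_upwards [ae_all_iff.2 hcj] with t ht
    ext j
    simp [ht j]

/-- The continuous representative of an element of `H¹((0,T))²` (unique on `[0,T]`). -/
noncomputable def H1.rep {T : ℝ} (W : H1 T) : ℝ → Plane := (H1.exists_continuous_rep W).choose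

/-- The squared `H¹` seminorm `∫₀ᵀ |W'(t)|² dt`. -/
noncomputable def H1.seminormSq {T : ℝ} (W : H1 T) : ℝ :=
  ∫ t, ‖W.1.snd t‖ ^ 2 ∂(timeMeasure T)

end SobolevSpace

/-- `W` is affine on each of the `N` intervals `[iT/N, (i+1)T/N]`, that is, on `[0,T]` it is the
piecewise affine interpolation of its values at the grid times `iT/N`, `0 ≤ i ≤ N`. -/
def IsPiecewiseAffine (T : ℝ) (N : ℕ) (W : ℝ → Plane) : Prop :=
  ∀ i < N, ∀ s ∈ Icc (0 : ℝ) 1,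
    W ((i + s) * T / N) = (1 - s) • W (i * T / N) + s • W ((i + 1) * T / N)

/-- The piecewise constant scan path: it rests at `x i` (counting from `i = 0`) during the interval
`[iT/N, (i+1)T/N)`. The value outside `[0,T)` plays no role. -/
noncomputable def scanPath (T : ℝ) {N : ℕ} (x : Fin N → Plane) (t : ℝ) : Plane :=
  if h : ⌊t * N / T⌋₊ < N then x ⟨⌊t * N / T⌋₊, h⟩ else 0

/-- Point configurations in the strip `[0,T] × [0,∞)` with finitely many points below every
level. -/
structure PointConfig (T : ℝ) where
  pts : Set (ℝ × ℝ)
  subset_strip : pts ⊆ Icc 0 T ×ˢ Ici 0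
  finite_below : ∀ l : ℝ, (pts ∩ {q | q.2 ≤ l}).Finite

/-- A random point set `Z` is a Poisson point process with intensity measure `ν`: the number of
points in a measurable set of finite intensity is Poisson distributed with mean the intensity of
that set, and the numbers of points in disjoint measurable sets are independent. -/
structure IsPoissonPointProcess {𝓞 X : Type*} [MeasurableSpace 𝓞] [MeasurableSpace X]
    (P : Measure 𝓞) (Z : 𝓞 → Set X) (ν : Measure X) : Prop where
  measurable_count : ∀ S, MeasurableSet S → Measurable fun ω => (Z ω ∩ S).encard
  law_count : ∀ S, MeasurableSet S → ν S ≠ ⊤ →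
    P.map (fun ω => (Z ω ∩ S).encard)
      = (ProbabilityTheory.poissonMeasure (ν S).toNNReal).map (Nat.cast : ℕ → ℕ∞)
  indep_count : ∀ (k : ℕ) (S : Fin k → Set X), (∀ i, MeasurableSet (S i)) →
    Pairwise (fun i j => Disjoint (S i) (S j)) →
    ProbabilityTheory.iIndepFun (fun i ω => (Z ω ∩ S i).encard) P

/-- A random configuration whose points form a Poisson point process of unit intensity on
`[0,T] × [0,∞)`. -/
def IsUnitPoissonProcess {𝓞 : Type*} [MeasurableSpace 𝓞] (P : Measure 𝓞) (T : ℝ)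
    (e : 𝓞 → PointConfig T) : Prop :=
  IsPoissonPointProcess P (fun ω => (e ω).pts) (volume.restrict (Icc 0 T ×ˢ Ici (0 : ℝ)))

/-- Gaussian white noise on `[0,T]`: independent standard normal variables, one for each time. -/
structure IsGaussianWhiteNoise {𝓞 : Type*} [MeasurableSpace 𝓞] (P : Measure 𝓞) (T : ℝ)
    (R : ℝ → 𝓞 → ℝ) : Prop where
  measurable : ∀ t ∈ Icc 0 T, Measurable (R t)
  law : ∀ t ∈ Icc 0 T, P.map (R t) = ProbabilityTheory.gaussianReal 0 1
  indep : ProbabilityTheory.iIndepFun (fun t : Icc (0 : ℝ) T => R t) P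

/-- The electron counting measure `∑ δ_τ`, the sum running over the points `(τ, l)` of the
configuration with `l ≤ lam τ`. -/
noncomputable def electronMeasure {T : ℝ} (e : PointConfig T) (lam : ℝ → ℝ) : Measure ℝ :=
  Measure.sum fun q : {q : ℝ × ℝ // q ∈ e.pts ∧ q.2 ≤ lam q.1} => Measure.dirac q.1.1

/-- The measured signal of the `N` pixels: gain times electron count in `[iT/N, (i+1)T/N)`, plus
Gaussian background noise with mean `μ` and standard deviation `σ`. -/
noncomputable def measuredSignal {T : ℝ} (α μ σ : ℝ) (N : ℕ) (e : PointConfig T) (r : ℝ → ℝ)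
    (lam : ℝ → ℝ) (i : Fin N) : ℝ :=
  α * (electronMeasure e lam).real (Ico (i * T / N) ((i + 1) * T / N))
    + (μ + σ * r ((i + 1) * T / N))

/-- The values on the `N` time intervals of the normalized signal `𝒢 = (g - μ) / (α Δt)`,
`Δt = T / N`. -/
noncomputable def normalizedSignal (T α μ : ℝ) {N : ℕ} (g : Fin N → ℝ) (i : Fin N) : ℝ :=
  (g i - μ) / (α * (T / N))

/-- The probability density of `α X + Y` at `g`, where `X` is Poisson distributed with mean `z` and
`Y` is normally distributed with mean `μ` and standard deviation `σ`, independent of `X`. -/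
noncomputable def dataDensity (α μ σ g z : ℝ) : ℝ :=
  ∑' k : ℕ, z ^ k * Real.exp (-z) / (k.factorial : ℝ) *
    (1 / (Real.sqrt (2 * Real.pi) * σ) * Real.exp (-(g - α * k - μ) ^ 2 / (2 * σ ^ 2)))

/-- The data dissimilarity. -/
noncomputable def dissimilarity (α μ σ g z : ℝ) : ℝ := -Real.log (dataDensity α μ σ g z)

/-- The convex-analytic indicator function `ι_A`. -/
noncomputable def indicatorFn {X : Type*} (A : Set X) (p : X) : EReal :=
  open Classical in if p ∈ A then 0 else ⊤

/-- The discrete MAP energy `E[w, p]` for `N` pixels at locations `x` with dwell time `T / N`,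
signal `g`, and accumulated motion `w = (w₀, …, w_N)`. -/
noncomputable def discreteEnergy {d : ℕ} (T D α μ σ : ℝ) (A : Set (EuclideanSpace ℝ (Fin d)))
    (ρ : EuclideanSpace ℝ (Fin d) → Plane → ℝ) {N : ℕ} (x : Fin N → Plane) (g : Fin N → ℝ)
    (w : Fin (N + 1) → Plane) (p : EuclideanSpace ℝ (Fin d)) : EReal :=
  ((∑ i : Fin N, dissimilarity α μ σ (g i) (T / N * ρ p (x i + w i.succ))
    + 1 / (2 * D) * ∑ i : Fin N, ‖w i.succ - w i.castSucc‖ ^ 2 / (T / N) : ℝ) : EReal)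
    + indicatorFn A p

/-- The discrete energy as a functional on `H¹((0,T))² × ℝᵈ`: finite only if `W` is the piecewise
affine interpolation of its values at the grid times and starts at `w₀`. -/
noncomputable def pathEnergy {d : ℕ} (T D α μ σ : ℝ) (A : Set (EuclideanSpace ℝ (Fin d)))
    (ρ : EuclideanSpace ℝ (Fin d) → Plane → ℝ) (w₀ : Plane) {N : ℕ} (x : Fin N → Plane)
    (g : Fin N → ℝ) (W : H1 T) (p : EuclideanSpace ℝ (Fin d)) : EReal :=
  open Classical in
  if IsPiecewiseAffine T N (H1.rep W) ∧ H1.rep W 0 = w₀ then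
    discreteEnergy T D α μ σ A ρ x g (fun i => H1.rep W (i * T / N)) p
  else ⊤

/-- The Kullback–Leibler data term `∫₀ᵀ u dt - ∫_[0,T] log u de`. -/
noncomputable def klDivergence (T : ℝ) (e : Measure ℝ) (u : ℝ → ℝ) : ℝ :=
  (∫ t in Icc 0 T, u t) - ∫ t in Icc 0 T, Real.log (u t) ∂e

/-- The limit energy on `H¹((0,T))² × ℝᵈ`. -/
noncomputable def limitEnergy {d : ℕ} (T D : ℝ) (A : Set (EuclideanSpace ℝ (Fin d)))
    (ρ : EuclideanSpace ℝ (Fin d) → Plane → ℝ) (w₀ : Plane) (x : ℝ → Plane) (e : Measure ℝ)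
    (W : H1 T) (p : EuclideanSpace ℝ (Fin d)) : EReal :=
  open Classical in
  if H1.rep W 0 = w₀ then
    ((klDivergence T e (fun t => ρ p (x t + H1.rep W t))
      + 1 / (2 * D) * H1.seminormSq W : ℝ) : EReal) + indicatorFn A p
  else ⊤

/-- `p ↦ ρ p` is a continuous map from `A` to the space `C^{0,1}(ℝ²)` of bounded Lipschitz functions
with the norm `sup |f| + Lip f`. -/
def ContinuousIntoLipschitz {d : ℕ} (A : Set (EuclideanSpace ℝ (Fin d)))
    (ρ : EuclideanSpace ℝ (Fin d) → Plane → ℝ) : Prop :=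
  (∀ p ∈ A, ∃ M : ℝ, (∀ y, |ρ p y| ≤ M) ∧ ∀ y z, |ρ p y - ρ p z| ≤ M * ‖y - z‖) ∧
  ∀ p ∈ A, ∀ ε > 0, ∃ δ > 0, ∀ q ∈ A, dist q p < δ →
    (∀ y, |ρ q y - ρ p y| ≤ ε) ∧
    ∀ y z, |(ρ q y - ρ p y) - (ρ q z - ρ p z)| ≤ ε * ‖y - z‖

/-- (Sequential) `Γ`-convergence of extended real functionals. -/
def GammaConverges {X : Type*} [TopologicalSpace X] (E : ℕ → X → EReal) (F : X → EReal) : Prop :=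
  (∀ (x : X) (u : ℕ → X), Tendsto u atTop (𝓝 x) →
    F x ≤ liminf (fun n => E n (u n)) atTop) ∧
  ∀ x : X, ∃ u : ℕ → X, Tendsto u atTop (𝓝 x) ∧ limsup (fun n => E n (u n)) atTop ≤ F x

/-- `x` is a global minimizer of `E`. -/
def IsMinimizer {X : Type*} (E : X → EReal) (x : X) : Prop := ∀ y, E x ≤ E y

/-- `H¹((0,T))² × ℝᵈ` with the product of the weak topology and the Euclidean topology. -/
abbrev WeakH1Prod (T : ℝ) (d : ℕ) : Type := WeakSpace ℝ (H1 T) × EuclideanSpace ℝ (Fin d)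

/-- A functional on `H¹((0,T))² × ℝᵈ`, regarded as a functional on that set with the weak-strong
product topology. -/
noncomputable def onWeak {T : ℝ} {d : ℕ} (E : H1 T → EuclideanSpace ℝ (Fin d) → EReal)
    (v : WeakH1Prod T d) : EReal :=
  E ((toWeakSpace ℝ (H1 T)).symm v.1) v.2

/-!
# Gamma-convergence of the discrete reconstruction energies

The randomness enters through two almost sure facts only; everything else is deterministic.

* Almost surely no point of the Poisson process lies on the graph of the limit intensity `λ^∞` or on
  the line of times `T`. The intensities `λⁿ` are uniformly bounded and converge pointwise, so only
  finitely many points matter, and for large `n` the electron measures of `λⁿ` and `λ^∞` are the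
  same finite sum of Dirac measures (`exists_electronMeasure_eventually_eq`).
* By the Gaussian tail and the Borel–Cantelli lemma, the noise at the `N` grid times is at most
  `N / 4` for large `N` (`IsGaussianWhiteNoise.ae_eventually_le`). Since `σⁿ Nⁿ → 0`, the noise in
  each pixel is eventually below `α / 4`, and the electron count `k` of a pixel is the integer
  nearest to the normalized signal times the dwell time.

In this situation the mixture density of the signal given the mean `z` is dominated by its `k`-th
summand, with relative error of order `(z + k / z) exp (-α² / (4 σ²))`
(`abs_dissimilarity_sub_le`). Hence the dissimilarity is `z - k log z` plus terms that depend only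
on `k`, the noise, and `σ`; the latter, together with the contribution `-k log Δt` of the dwell time
in `z = Δt u`, are collected in `normalizationConstant`. What remains is
`∑ Δt uᵢ - ∑ kᵢ log uᵢ`, that is, the integral of a step function minus a sum over the finitely many
electron events (`sum_data_eq`). Along weakly convergent paths and convergent parameters it converges
by dominated convergence to the Kullback–Leibler term (`tendsto_sum_data`): weak convergence in `H¹`
implies pointwise convergence and a common Hölder bound, which absorbs the difference between an
event time and the grid time at which the path is sampled.

The kinetic term of a piecewise affine path is its squared `H¹` seminorm (`H1.seminormSq_interp`),
which is weakly lower semicontinuous. This gives the liminf inequality. Recovery sequences are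
piecewise affine interpolations, whose energy is at most that of the path by Jensen's inequality
(`H1.seminormSq_interp_le`). Since the data term is bounded below, minimizers are bounded in `H¹`,
and weak sequential compactness yields the convergence of subsequences; the limit is a minimizer by
the general property `GammaConverges.isMinimizer_of_tendsto` of Gamma-limits.
-/

/-! ### Weak convergence in Hilbert spaces -/

theorem tendsto_weakSpace_iff {E : Type*} [NormedAddCommGroup E] [NormedSpace ℝ E]
    {ι : Type*} {l : Filter ι} {u : ι → WeakSpace ℝ E} {v : WeakSpace ℝ E} :
    Tendsto u l (𝓝 v) ↔ ∀ f : StrongDual ℝ E,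
      Tendsto (fun n => f ((toWeakSpace ℝ E).symm (u n))) l
        (𝓝 (f ((toWeakSpace ℝ E).symm v))) := by
  refine WeakBilin.tendsto_iff_forall_eval_tendsto (topDualPairing ℝ E).flip ?_
  intro x y hxy
  by_contra hne
  obtain ⟨f, hf⟩ := SeparatingDual.exists_separating_of_ne (R := ℝ) hne
  exact hf (congrArg (fun g : StrongDual ℝ E →ₗ[ℝ] ℝ => g f) hxy)

/-- Bounded sequences in a separable Hilbert space have weakly convergent subsequences. -/
theorem exists_subseq_tendsto_weakly {E : Type*} [NormedAddCommGroup E] [InnerProductSpace ℝ E]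
    [CompleteSpace E] [TopologicalSpace.SeparableSpace E] {u : ℕ → E} {B : ℝ}
    (hu : ∀ n, ‖u n‖ ≤ B) :
    ∃ (v : E) (φ : ℕ → ℕ), StrictMono φ ∧
      ∀ f : StrongDual ℝ E, Tendsto (fun n => f (u (φ n))) atTop (𝓝 (f v)) := by
  obtain ⟨ℓ, -, φ, hφ, hlim⟩ := WeakDual.isSeqCompact_closedBall ℝ E 0 B
    (x := fun n => StrongDual.toWeakDual (InnerProductSpace.toDual ℝ E (u n)))
    (fun n => by
      simp only [mem_preimage, mem_closedBall_zero_iff]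
      exact ((InnerProductSpace.toDual ℝ E).norm_map (u n)).trans_le (hu n))
  refine ⟨(InnerProductSpace.toDual ℝ E).symm (WeakDual.toStrongDual ℓ), φ, hφ, fun f => ?_⟩
  obtain ⟨z, rfl⟩ := (InnerProductSpace.toDual ℝ E).surjective f
  have := ((WeakDual.eval_continuous z).tendsto ℓ).comp hlim
  simp only [InnerProductSpace.toDual_apply_apply]
  rw [real_inner_comm, InnerProductSpace.toDual_symm_apply]
  refine this.congr fun n => ?_
  exact real_inner_comm _ _

/-- Weakly convergent sequences are bounded. -/
theorem exists_norm_le_of_tendsto_weakly {E : Type*} [NormedAddCommGroup E] [NormedSpace ℝ E]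
    {u : ℕ → E} {v : E}
    (hu : ∀ f : StrongDual ℝ E, Tendsto (fun n => f (u n)) atTop (𝓝 (f v))) :
    ∃ B, ∀ n, ‖u n‖ ≤ B := by
  obtain ⟨B, hB⟩ := banach_steinhaus
    (g := fun n => NormedSpace.inclusionInDoubleDual ℝ E (u n)) (fun f => by
      obtain ⟨C, hC⟩ := ((hu f).norm.bddAbove_range)
      exact ⟨C, fun n => hC ⟨n, rfl⟩⟩)
  refine ⟨B, fun n => ?_⟩
  have := hB n
  rwa [show ‖NormedSpace.inclusionInDoubleDual ℝ E (u n)‖ = ‖u n‖ from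
    (NormedSpace.inclusionInDoubleDualLi ℝ (E := E)).norm_map (u n)] at this

/-! ### The continuous representative of an `H¹` path -/

theorem H1.continuousOn_rep {T : ℝ} (W : H1 T) : ContinuousOn (H1.rep W) (Icc 0 T) :=
  (H1.exists_continuous_rep W).choose_spec.1

theorem H1.rep_ae_eq {T : ℝ} (W : H1 T) : H1.rep W =ᵐ[timeMeasure T] W.1.fst :=
  (H1.exists_continuous_rep W).choose_spec.2

theorem eqOn_Icc_of_ae_eq_timeMeasure {T : ℝ} (hT : 0 < T) {f g : ℝ → Plane}
    (hf : ContinuousOn f (Icc 0 T)) (hg : ContinuousOn g (Icc 0 T))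
    (h : f =ᵐ[timeMeasure T] g) : EqOn f g (Icc 0 T) := by
  refine Measure.eqOn_Icc_of_ae_eq volume hT.ne ?_ hf hg
  rwa [← Measure.restrict_congr_set Ioo_ae_eq_Icc]

theorem integrable_of_memLp_two {T : ℝ} {V : ℝ → Plane} (hV : MemLp V 2 (timeMeasure T)) :
    Integrable V (timeMeasure T) := hV.integrable (by norm_num)

theorem intervalIntegrable_of_timeMeasure {E : Type*} [NormedAddCommGroup E] {T s t : ℝ}
    {V : ℝ → E} (hV : Integrable V (timeMeasure T)) (hs : s ∈ Icc 0 T) (ht : t ∈ Icc 0 T) :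
    IntervalIntegrable V volume s t := by
  have h0 : IntervalIntegrable V volume 0 T := by
    rw [intervalIntegrable_iff_integrableOn_Ioo_of_le (hs.1.trans hs.2)]; exact hV
  refine h0.mono_set ?_
  rw [uIcc_of_le (hs.1.trans hs.2)]
  exact uIcc_subset_Icc hs ht

theorem continuousOn_const_add_integral {T : ℝ} (hT : 0 < T) {V : ℝ → Plane}
    (hV : Integrable V (timeMeasure T)) (c : Plane) :
    ContinuousOn (fun t => c + ∫ s in (0 : ℝ)..t, V s) (Icc 0 T) := by
  refine continuousOn_const.add ?_
  have := intervalIntegral.continuousOn_primitive_interval (a := 0) (b := T) (f := V) (μ := volume)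
    (by rw [uIcc_of_le hT.le, integrableOn_Icc_iff_integrableOn_Ioo]; exact hV)
  rwa [uIcc_of_le hT.le] at this

theorem intervalIntegral_apply {a b : ℝ} {V : ℝ → Plane} (hV : IntervalIntegrable V volume a b)
    (j : Fin 2) : (∫ s in a..b, V s) j = ∫ s in a..b, V s j :=
  ((EuclideanSpace.proj j : Plane →L[ℝ] ℝ).intervalIntegral_comp_comm hV).symm

theorem integrable_apply {T : ℝ} {V : ℝ → Plane} (hV : Integrable V (timeMeasure T)) (j : Fin 2) :
    Integrable (fun t => V t j) (timeMeasure T) :=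
  (EuclideanSpace.proj (𝕜 := ℝ) j).integrable_comp hV

theorem integral_apply {T : ℝ} {V : ℝ → Plane} (hV : Integrable V (timeMeasure T)) (j : Fin 2) :
    (∫ t, V t ∂(timeMeasure T)) j = ∫ t, V t j ∂(timeMeasure T) :=
  ((EuclideanSpace.proj j : Plane →L[ℝ] ℝ).integral_comp_comm hV).symm

theorem H1.integrable_snd {T : ℝ} (W : H1 T) : Integrable W.1.snd (timeMeasure T) :=
  integrable_of_memLp_two (Lp.memLp _)

theorem H1.rep_eq {T : ℝ} (hT : 0 < T) (W : H1 T) {t : ℝ} (ht : t ∈ Icc 0 T) :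
    H1.rep W t = H1.rep W 0 + ∫ s in (0 : ℝ)..t, W.1.snd s := by
  have hfi : Integrable W.1.fst (timeMeasure T) := integrable_of_memLp_two (Lp.memLp _)
  have hj : ∀ j : Fin 2, ∃ c : ℝ, ∀ᵐ t ∂(timeMeasure T),
      W.1.fst t j = c + ∫ s in (0 : ℝ)..t, W.1.snd s j := by
    intro j
    refine ae_eq_const_add_integral_of_weakDeriv hT (integrable_apply hfi j)
      (integrable_apply (H1.integrable_snd W) j) ?_
    intro φ h1 h2 h3
    have hw := congrArg (fun v : Plane => v j) (W.2 φ h1 h2 h3)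
    have hd : Continuous (deriv φ) := h1.continuous_deriv (by simp)
    simp only [PiLp.neg_apply] at hw
    rw [integral_apply (integrable_smul_of_compactSupport hd h2.deriv _) j,
      integral_apply (integrable_smul_of_compactSupport h1.continuous h2 _) j] at hw
    simpa using hw
  choose c hcj using hj
  have key : EqOn (H1.rep W) (fun t => WithLp.toLp 2 c + ∫ s in (0 : ℝ)..t, W.1.snd s)
      (Icc 0 T) := by
    refine eqOn_Icc_of_ae_eq_timeMeasure hT (H1.continuousOn_rep W)
      (continuousOn_const_add_integral hT (H1.integrable_snd W) _) ?_
    filter_upwards [ae_all_iff.2 hcj, (H1.rep_ae_eq W), ae_restrict_mem measurableSet_Ioo]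
      with t h1 h2 h3
    rw [h2]
    ext j
    rw [h1 j, PiLp.add_apply, intervalIntegral_apply]
    exact intervalIntegrable_of_timeMeasure (H1.integrable_snd W) ⟨le_rfl, hT.le⟩ ⟨h3.1.le, h3.2.le⟩
  have h0 := key ⟨le_rfl, hT.le⟩
  simp only [intervalIntegral.integral_same, add_zero] at h0
  rw [key ht, h0]

theorem H1.rep_sub {T : ℝ} (hT : 0 < T) (W : H1 T) {s t : ℝ} (hs : s ∈ Icc 0 T)
    (ht : t ∈ Icc 0 T) : H1.rep W t - H1.rep W s = ∫ r in s..t, W.1.snd r := by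
  have h0 : (0 : ℝ) ∈ Icc 0 T := ⟨le_rfl, hT.le⟩
  rw [H1.rep_eq hT W ht, H1.rep_eq hT W hs, add_sub_add_left_eq_sub,
    intervalIntegral.integral_interval_sub_left]
  · exact intervalIntegrable_of_timeMeasure (H1.integrable_snd W) h0 ht
  · exact intervalIntegrable_of_timeMeasure (H1.integrable_snd W) h0 hs

/-- A path with square integrable velocity is an element of `H¹`. -/
theorem H1.exists_mk {T : ℝ} (hT : 0 < T) (c : Plane) {V : ℝ → Plane}
    (hV : MemLp V 2 (timeMeasure T)) :
    ∃ W : H1 T, W.1.snd =ᵐ[timeMeasure T] V ∧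
      ∀ t ∈ Icc 0 T, H1.rep W t = c + ∫ s in (0 : ℝ)..t, V s := by
  have hVi := integrable_of_memLp_two hV
  set F : ℝ → Plane := fun t => c + ∫ s in (0 : ℝ)..t, V s with hF
  have hFc : ContinuousOn F (Icc 0 T) := continuousOn_const_add_integral hT hVi c
  have h0T : (0 : ℝ) ∈ Icc 0 T := ⟨le_rfl, hT.le⟩
  have hFm : MemLp F 2 (timeMeasure T) := by
    obtain ⟨C, hC⟩ := isCompact_Icc.exists_bound_of_continuousOn hFc
    refine MemLp.of_bound ?_ C ?_
    · exact (hFc.mono Ioo_subset_Icc_self).aestronglyMeasurable measurableSet_Ioo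
    · filter_upwards [ae_restrict_mem measurableSet_Ioo] with t ht
      exact hC t (Ioo_subset_Icc_self ht)
  have hweak : HasWeakDeriv T F V := by
    intro φ h1 h2 h3
    have hd : Continuous (deriv φ) := h1.continuous_deriv (by simp)
    have bdd : ∀ (u : ℝ → ℝ) (v : ℝ → Plane), Continuous u → HasCompactSupport u →
        Integrable v (timeMeasure T) → Integrable (fun t => u t • v t) (timeMeasure T) := by
      intro u v hu huc hv
      obtain ⟨C, hC⟩ := hu.bounded_above_of_compact_support huc
      exact hv.bdd_smul C hu.aestronglyMeasurable (Eventually.of_forall hC)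
    have conv : ∀ u : ℝ → ℝ, ∫ t, u t ∂(timeMeasure T) = ∫ t in (0 : ℝ)..T, u t := by
      intro u
      rw [intervalIntegral.integral_of_le hT.le, integral_Ioc_eq_integral_Ioo]
    ext j
    rw [integral_apply (bdd _ _ hd h2.deriv (integrable_of_memLp_two hFm)), PiLp.neg_apply,
      integral_apply (bdd _ _ h1.continuous h2 hVi)]
    simp only [PiLp.smul_apply, smul_eq_mul]
    have hgi : IntervalIntegrable (fun t => V t j) volume 0 T :=
      intervalIntegrable_of_timeMeasure (integrable_apply hVi j) h0T ⟨hT.le, le_rfl⟩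
    set G : ℝ → ℝ := fun t => c j + ∫ s in (0 : ℝ)..t, V s j with hG
    have hGac : AbsolutelyContinuousOnInterval G 0 T :=
      ((LipschitzWith.const (c j)).lipschitzOnWith.absolutelyContinuousOnInterval).add
      (hgi.absolutelyContinuousOnInterval_intervalIntegral left_mem_uIcc)
    have hφac : AbsolutelyContinuousOnInterval φ 0 T :=
      (h1.of_le (by simp)).contDiffOn.absolutelyContinuousOnInterval
    have z0 : φ 0 = 0 := by
      by_contra hne
      exact absurd (h3 (subset_tsupport _ hne)).1 (lt_irrefl _)
    have zT : φ T = 0 := by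
      by_contra hne
      exact absurd (h3 (subset_tsupport _ hne)).2 (lt_irrefl _)
    have ibp := hφac.integral_mul_deriv_eq_deriv_mul hGac
    rw [z0, zT, ← conv, ← conv] at ibp
    have e1 : ∫ t, φ t * deriv G t ∂(timeMeasure T) = ∫ t, φ t * V t j ∂(timeMeasure T) := by
      refine integral_congr_ae ?_
      rw [EventuallyEq, ae_restrict_iff' measurableSet_Ioo]
      filter_upwards [hgi.ae_hasDerivAt_integral] with t ht hmem
      have hu : uIcc 0 T = Icc 0 T := uIcc_of_le hT.le
      rw [((ht (hu ▸ Ioo_subset_Icc_self hmem) 0 (by simp)).const_add (c j)).deriv]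
    have e2 : ∫ t, deriv φ t * F t j ∂(timeMeasure T)
        = ∫ t, deriv φ t * G t ∂(timeMeasure T) := by
      refine integral_congr_ae ?_
      filter_upwards [ae_restrict_mem measurableSet_Ioo] with t ht
      simp only [hF, hG, PiLp.add_apply]
      rw [intervalIntegral_apply]
      exact intervalIntegrable_of_timeMeasure hVi h0T (Ioo_subset_Icc_self ht)
    rw [e1] at ibp
    rw [e2]
    linarith
  let W : H1 T := ⟨WithLp.toLp 2 (hFm.toLp F, hV.toLp V), by
    intro φ h1 h2 h3
    have := hweak φ h1 h2 h3
    have a1 : ∫ t, deriv φ t • (hFm.toLp F) t ∂(timeMeasure T)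
        = ∫ t, deriv φ t • F t ∂(timeMeasure T) :=
      integral_congr_ae (by filter_upwards [hFm.coeFn_toLp] with t ht; rw [ht])
    have a2 : ∫ t, φ t • (hV.toLp V) t ∂(timeMeasure T)
        = ∫ t, φ t • V t ∂(timeMeasure T) :=
      integral_congr_ae (by filter_upwards [hV.coeFn_toLp] with t ht; rw [ht])
    exact a1.trans (this.trans (congrArg Neg.neg a2.symm))⟩
  refine ⟨W, hV.coeFn_toLp, ?_⟩
  have hfst : W.1.fst =ᵐ[timeMeasure T] F := hFm.coeFn_toLp
  exact eqOn_Icc_of_ae_eq_timeMeasure hT (H1.continuousOn_rep W) hFc ((H1.rep_ae_eq W).trans hfst)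

/-- An element of `H¹` is determined by its continuous representative. -/
theorem H1.ext_rep {T : ℝ} {W W' : H1 T}
    (h : EqOn (H1.rep W) (H1.rep W') (Icc 0 T)) : W = W' := by
  have h1 : W.1.fst = W'.1.fst := by
    refine Lp.ext ?_
    filter_upwards [H1.rep_ae_eq W, H1.rep_ae_eq W', ae_restrict_mem measurableSet_Ioo]
      with t a b ht
    rw [← a, ← b, h (Ioo_subset_Icc_self ht)]
  have h2 : W.1.snd = W'.1.snd := by
    refine Lp.ext ?_
    have loc : LocallyIntegrableOn (fun t => W.1.snd t - W'.1.snd t) (Ioo 0 T) volume :=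
      IntegrableOn.locallyIntegrableOn ((H1.integrable_snd W).sub (H1.integrable_snd W'))
    have key := isOpen_Ioo.ae_eq_zero_of_integral_contDiff_smul_eq_zero loc (fun φ a b c => by
      have e := W.2 φ a b c
      rw [h1, W'.2 φ a b c, neg_inj] at e
      have hz : ∫ t, φ t • (W.1.snd t - W'.1.snd t) ∂(timeMeasure T) = 0 := by
        simp only [smul_sub]
        rw [integral_sub (integrable_smul_of_compactSupport a.continuous b _)
          (integrable_smul_of_compactSupport a.continuous b _), e, sub_self]
      rw [← hz]
      symm
      refine setIntegral_eq_integral_of_forall_compl_eq_zero fun t ht => ?_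
      rw [image_eq_zero_of_notMem_tsupport fun h => ht (c h), zero_smul])
    rw [EventuallyEq, ae_restrict_iff' measurableSet_Ioo]
    filter_upwards [key] with t ht hm
    exact sub_eq_zero.1 (ht hm)
  apply Subtype.ext
  apply WithLp.ofLp_injective
  exact Prod.ext h1 h2

/-! ### Evaluation, compactness and lower semicontinuity in `H¹` -/

theorem H1.seminormSq_eq {T : ℝ} (W : H1 T) : H1.seminormSq W = ‖W.1.snd‖ ^ 2 := by
  rw [← real_inner_self_eq_norm_sq, L2.inner_def, H1.seminormSq]
  simp only [real_inner_self_eq_norm_sq]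

theorem integral_rep_sq_eq {T : ℝ} (W : H1 T) :
    ∫ t, ‖H1.rep W t‖ ^ 2 ∂(timeMeasure T) = ‖W.1.fst‖ ^ 2 := by
  rw [← real_inner_self_eq_norm_sq, L2.inner_def]
  simp only [real_inner_self_eq_norm_sq]
  refine integral_congr_ae ?_
  filter_upwards [H1.rep_ae_eq W] with t ht
  rw [ht]

theorem H1.norm_sq_eq {T : ℝ} (W : H1 T) : ‖W‖ ^ 2 = ‖W.1.fst‖ ^ 2 + ‖W.1.snd‖ ^ 2 :=
  WithLp.prod_norm_sq_eq_of_L2 W.1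

theorem H1.seminormSq_nonneg {T : ℝ} (W : H1 T) : 0 ≤ H1.seminormSq W := by
  rw [H1.seminormSq_eq]; positivity

theorem H1.seminormSq_le_norm_sq {T : ℝ} (W : H1 T) : H1.seminormSq W ≤ ‖W‖ ^ 2 := by
  rw [H1.norm_sq_eq, H1.seminormSq_eq]; nlinarith [sq_nonneg ‖W.1.fst‖]

/-- The Cauchy–Schwarz (or Jensen) inequality for an integral over an interval. -/
theorem norm_intervalIntegral_sq_le {E : Type*} [NormedAddCommGroup E] [NormedSpace ℝ E]
    {s t : ℝ} (hst : s ≤ t) {V : ℝ → E}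
    (hV : IntervalIntegrable V volume s t)
    (hV2 : IntervalIntegrable (fun r => ‖V r‖ ^ 2) volume s t) :
    ‖∫ r in s..t, V r‖ ^ 2 ≤ (t - s) * ∫ r in s..t, ‖V r‖ ^ 2 := by
  rcases hst.eq_or_lt with rfl | hlt
  · simp
  set m := ∫ r in s..t, ‖V r‖ with hm
  have h1 : ‖∫ r in s..t, V r‖ ≤ m := intervalIntegral.norm_integral_le_integral_norm hst
  have h2 : 0 ≤ ∫ r in s..t, ((t - s) * ‖V r‖ - m) ^ 2 :=
    intervalIntegral.integral_nonneg hst fun r _ => sq_nonneg _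
  have h3 : ∫ r in s..t, ((t - s) * ‖V r‖ - m) ^ 2
      = (t - s) ^ 2 * (∫ r in s..t, ‖V r‖ ^ 2) - (2 * m * (t - s)) * m + (t - s) * m ^ 2 := by
    have e : ∀ r, ((t - s) * ‖V r‖ - m) ^ 2
        = (t - s) ^ 2 * ‖V r‖ ^ 2 - (2 * m * (t - s)) * ‖V r‖ + m ^ 2 := fun r => by ring
    simp only [e]
    rw [intervalIntegral.integral_add, intervalIntegral.integral_sub,
      intervalIntegral.integral_const_mul, intervalIntegral.integral_const_mul,
      intervalIntegral.integral_const, smul_eq_mul]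
    · exact hV2.const_mul _
    · exact hV.norm.const_mul _
    · exact (hV2.const_mul _).sub (hV.norm.const_mul _)
    · exact intervalIntegrable_const
  have h4 : 0 ≤ (t - s) * ((t - s) * (∫ r in s..t, ‖V r‖ ^ 2) - m ^ 2) := by
    rw [h3] at h2; linarith
  have h5 : m ^ 2 ≤ (t - s) * ∫ r in s..t, ‖V r‖ ^ 2 := by
    have := nonneg_of_mul_nonneg_right h4 (sub_pos.2 hlt)
    linarith
  exact (pow_le_pow_left₀ (norm_nonneg _) h1 2).trans h5

theorem H1.integrable_snd_sq {T : ℝ} (W : H1 T) :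
    Integrable (fun t => ‖W.1.snd t‖ ^ 2) (timeMeasure T) :=
  (Lp.memLp W.1.snd).integrable_norm_pow (by norm_num)

theorem H1.integral_snd_sq_le {T : ℝ} (W : H1 T) {s t : ℝ} (hs : s ∈ Icc 0 T)
    (ht : t ∈ Icc 0 T) (hst : s ≤ t) : ∫ r in s..t, ‖W.1.snd r‖ ^ 2 ≤ H1.seminormSq W := by
  rw [intervalIntegral.integral_of_le hst, integral_Ioc_eq_integral_Ioo]
  exact setIntegral_mono_set (H1.integrable_snd_sq W)
    (Eventually.of_forall fun r => sq_nonneg _) (Ioo_subset_Ioo hs.1 ht.2).eventuallyLE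

/-- Paths of finite energy are Hölder continuous with exponent `1/2`. -/
theorem H1.norm_rep_sub_sq_le {T : ℝ} (hT : 0 < T) (W : H1 T) {s t : ℝ} (hs : s ∈ Icc 0 T)
    (ht : t ∈ Icc 0 T) :
    ‖H1.rep W t - H1.rep W s‖ ^ 2 ≤ |t - s| * H1.seminormSq W := by
  wlog hst : s ≤ t generalizing s t
  · rw [norm_sub_rev, abs_sub_comm]
    exact this ht hs (le_of_not_ge hst)
  rw [H1.rep_sub hT W hs ht, abs_of_nonneg (sub_nonneg.2 hst)]
  refine (norm_intervalIntegral_sq_le hst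
    (intervalIntegrable_of_timeMeasure (H1.integrable_snd W) hs ht)
    (intervalIntegrable_of_timeMeasure (H1.integrable_snd_sq W) hs ht)).trans ?_
  exact mul_le_mul_of_nonneg_left (H1.integral_snd_sq_le W hs ht hst) (sub_nonneg.2 hst)

theorem H1.norm_rep_sub_le {T : ℝ} (hT : 0 < T) (W : H1 T) {s t : ℝ} (hs : s ∈ Icc 0 T)
    (ht : t ∈ Icc 0 T) :
    ‖H1.rep W t - H1.rep W s‖ ≤ √(|t - s| * H1.seminormSq W) :=
  Real.le_sqrt_of_sq_le (H1.norm_rep_sub_sq_le hT W hs ht)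

theorem integral_timeMeasure_const {T : ℝ} (hT : 0 < T) (c : ℝ) :
    ∫ _, c ∂(timeMeasure T) = T * c := by
  simp [hT.le]

theorem H1.integrable_rep_sq {T : ℝ} (W : H1 T) :
    Integrable (fun t => ‖H1.rep W t‖ ^ 2) (timeMeasure T) := by
  refine ((Lp.memLp W.1.fst).integrable_norm_pow (p := 2) (by norm_num)).congr ?_
  filter_upwards [H1.rep_ae_eq W] with t ht
  rw [ht]

/-- The Sobolev embedding into the continuous functions: point evaluation is bounded. -/
theorem H1.norm_rep_le {T : ℝ} (hT : 0 < T) (W : H1 T) {t : ℝ} (ht : t ∈ Icc 0 T) :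
    ‖H1.rep W t‖ ≤ √(2 / T + 2 * T) * ‖W‖ := by
  have h1 : T * ‖H1.rep W t‖ ^ 2
      ≤ ∫ s, (2 * ‖H1.rep W s‖ ^ 2 + 2 * (T * H1.seminormSq W)) ∂(timeMeasure T) := by
    rw [← integral_timeMeasure_const hT]
    refine integral_mono_ae (integrable_const _)
      (((H1.integrable_rep_sq W).const_mul 2).add (integrable_const _)) ?_
    filter_upwards [ae_restrict_mem measurableSet_Ioo] with s hs
    have hs' := Ioo_subset_Icc_self hs
    have h2 := H1.norm_rep_sub_sq_le hT W hs' ht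
    have h3 : |t - s| * H1.seminormSq W ≤ T * H1.seminormSq W := by
      refine mul_le_mul_of_nonneg_right ?_ (H1.seminormSq_nonneg W)
      rw [abs_le]; constructor <;> linarith [hs'.1, hs'.2, ht.1, ht.2]
    have h4 : ‖H1.rep W t‖ ≤ ‖H1.rep W s‖ + ‖H1.rep W t - H1.rep W s‖ := by
      simpa using norm_add_le (H1.rep W s) (H1.rep W t - H1.rep W s)
    have h5 := pow_le_pow_left₀ (norm_nonneg _) h4 2
    nlinarith [sq_nonneg (‖H1.rep W s‖ - ‖H1.rep W t - H1.rep W s‖)]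
  rw [integral_add ((H1.integrable_rep_sq W).const_mul 2) (integrable_const _),
    integral_const_mul, integral_timeMeasure_const hT, integral_rep_sq_eq] at h1
  rw [← Real.sqrt_sq (norm_nonneg W), ← Real.sqrt_mul (by positivity)]
  apply Real.le_sqrt_of_sq_le
  have h6 : ‖W.1.fst‖ ^ 2 ≤ ‖W‖ ^ 2 := by rw [H1.norm_sq_eq]; nlinarith [sq_nonneg ‖W.1.snd‖]
  have h7 := H1.seminormSq_le_norm_sq W
  have h8 : T * ‖H1.rep W t‖ ^ 2 ≤ T * ((2 / T + 2 * T) * ‖W‖ ^ 2) := by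
    have e : T * ((2 / T + 2 * T) * ‖W‖ ^ 2) = 2 * ‖W‖ ^ 2 + T * (2 * (T * ‖W‖ ^ 2)) := by
      field_simp
    rw [e]
    refine h1.trans (add_le_add (by linarith) ?_)
    gcongr
  exact le_of_mul_le_mul_left h8 hT

theorem H1.rep_add {T : ℝ} (hT : 0 < T) (W W' : H1 T) {t : ℝ} (ht : t ∈ Icc 0 T) :
    H1.rep (W + W') t = H1.rep W t + H1.rep W' t := by
  refine eqOn_Icc_of_ae_eq_timeMeasure hT (H1.continuousOn_rep _)
    ((H1.continuousOn_rep W).add (H1.continuousOn_rep W')) ?_ ht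
  filter_upwards [H1.rep_ae_eq W, H1.rep_ae_eq W', H1.rep_ae_eq (W + W'),
    Lp.coeFn_add W.1.fst W'.1.fst] with s h1 h2 h3 h4
  rw [h3, Pi.add_apply, h1, h2]
  exact h4

theorem H1.rep_smul {T : ℝ} (hT : 0 < T) (c : ℝ) (W : H1 T) {t : ℝ} (ht : t ∈ Icc 0 T) :
    H1.rep (c • W) t = c • H1.rep W t := by
  refine eqOn_Icc_of_ae_eq_timeMeasure hT (H1.continuousOn_rep _)
    ((H1.continuousOn_rep W).const_smul c) ?_ ht
  filter_upwards [H1.rep_ae_eq W, H1.rep_ae_eq (c • W), Lp.coeFn_smul c W.1.fst] with s h1 h2 h3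
  rw [h2, Pi.smul_apply, h1]
  exact h3

/-- Evaluation of the continuous representative at a point of `[0,T]`. -/
noncomputable def H1.evalCLM {T : ℝ} (hT : 0 < T) (t : Icc 0 T) : H1 T →L[ℝ] Plane :=
  LinearMap.mkContinuous
    { toFun := fun W => H1.rep W t
      map_add' := fun W W' => H1.rep_add hT W W' t.2
      map_smul' := fun c W => H1.rep_smul hT c W t.2 }
    (√(2 / T + 2 * T)) (fun W => H1.norm_rep_le hT W t.2)

/-- Weak convergence in `H¹` implies pointwise convergence of the continuous representatives. -/
theorem H1.tendsto_rep {T : ℝ} (hT : 0 < T) {ι : Type*} {l : Filter ι} {U : ι → H1 T} {W : H1 T}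
    (h : ∀ f : StrongDual ℝ (H1 T), Tendsto (fun n => f (U n)) l (𝓝 (f W)))
    {t : ℝ} (ht : t ∈ Icc 0 T) : Tendsto (fun n => H1.rep (U n) t) l (𝓝 (H1.rep W t)) := by
  have hc : ∀ j : Fin 2, Tendsto (fun n => H1.rep (U n) t j) l (𝓝 (H1.rep W t j)) := fun j =>
    h ((EuclideanSpace.proj j : Plane →L[ℝ] ℝ) ∘L H1.evalCLM hT ⟨t, ht⟩)
  have := ((PiLp.continuous_toLp 2 (fun _ : Fin 2 => ℝ)).tendsto (fun j => H1.rep W t j)).comp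
    (tendsto_pi_nhds.2 hc)
  exact this

/-- The energy is weakly lower semicontinuous. -/
theorem H1.eventually_lt_seminormSq {T : ℝ} {ι : Type*} {l : Filter ι} {U : ι → H1 T} {W : H1 T}
    (h : ∀ f : StrongDual ℝ (H1 T), Tendsto (fun n => f (U n)) l (𝓝 (f W)))
    {b : ℝ} (hb : b < H1.seminormSq W) : ∀ᶠ n in l, b < H1.seminormSq (U n) := by
  let f : StrongDual ℝ (H1 T) :=
    (innerSL ℝ W.1.snd) ∘L (WithLp.sndL 2 ℝ _ _) ∘L (H1 T).subtypeL
  have hf : ∀ U : H1 T, f U = inner ℝ W.1.snd U.1.snd := fun U => rfl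
  have h1 : Tendsto (fun n => 2 * f (U n) - H1.seminormSq W) l (𝓝 (H1.seminormSq W)) := by
    have := ((h f).const_mul 2).sub_const (H1.seminormSq W)
    rwa [hf W, real_inner_self_eq_norm_sq, ← H1.seminormSq_eq,
      show 2 * H1.seminormSq W - H1.seminormSq W = H1.seminormSq W by ring] at this
  filter_upwards [h1.eventually_const_lt hb] with n hn
  refine hn.trans_le ?_
  rw [hf, H1.seminormSq_eq, H1.seminormSq_eq]
  have h2 := real_inner_le_norm W.1.snd (U n).1.snd
  nlinarith [sq_nonneg (‖W.1.snd‖ - ‖(U n).1.snd‖)]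

theorem H1.isClosed (T : ℝ) :
    IsClosed (H1 T : Set (WithLp 2 (Lp Plane 2 (timeMeasure T) × Lp Plane 2 (timeMeasure T)))) := by
  have hcont : ∀ φ : ℝ → ℝ, Continuous φ → HasCompactSupport φ →
      Continuous fun f : Lp Plane 2 (timeMeasure T) => ∫ t, φ t • f t ∂(timeMeasure T) := by
    intro φ hφ hc
    obtain ⟨C, hC⟩ := hφ.bounded_above_of_compact_support hc
    have hφm : MemLp φ 2 (timeMeasure T) :=
      MemLp.of_bound hφ.aestronglyMeasurable C (Eventually.of_forall hC)
    let ψ : Lp ℝ 2 (timeMeasure T) := hφm.toLp φ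
    refine continuous_of_linear_of_bound (𝕜 := ℝ) (C := ‖ψ‖) ?_ ?_ ?_
    · intro f g
      rw [← integral_add (integrable_smul_of_compactSupport hφ hc _)
        (integrable_smul_of_compactSupport hφ hc _)]
      refine integral_congr_ae ?_
      filter_upwards [Lp.coeFn_add f g] with t ht
      rw [ht, Pi.add_apply, smul_add]
    · intro c f
      rw [← integral_smul]
      refine integral_congr_ae ?_
      filter_upwards [Lp.coeFn_smul c f] with t ht
      rw [ht, Pi.smul_apply, smul_comm]
    · intro f
      refine (norm_integral_le_integral_norm _).trans ?_
      have hfn : MemLp (fun t => ‖f t‖) 2 (timeMeasure T) := (Lp.memLp f).norm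
      have hφn : MemLp (fun t => ‖φ t‖) 2 (timeMeasure T) := hφm.norm
      have := real_inner_le_norm (hφn.toLp _) (hfn.toLp _)
      rw [L2.inner_def] at this
      have e : ∫ t, ‖φ t • f t‖ ∂(timeMeasure T)
          = ∫ t, inner ℝ ((hφn.toLp _) t) ((hfn.toLp _) t) ∂(timeMeasure T) := by
        refine integral_congr_ae ?_
        filter_upwards [hφn.coeFn_toLp, hfn.coeFn_toLp] with t h1 h2
        rw [h1, h2, norm_smul, real_inner_comm]
        rfl
      rw [e]
      refine this.trans (le_of_eq ?_)
      have n1 : ‖hφn.toLp _‖ = ‖ψ‖ := by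
        rw [Lp.norm_toLp, Lp.norm_toLp, eLpNorm_norm]
      have n2 : ‖hfn.toLp _‖ = ‖f‖ := by
        rw [Lp.norm_toLp, eLpNorm_norm, Lp.norm_def]
      rw [n1, n2]
  have : (H1 T : Set (WithLp 2 (Lp Plane 2 (timeMeasure T) × Lp Plane 2 (timeMeasure T))))
      = ⋂ (φ : ℝ → ℝ) (_ : ContDiff ℝ (⊤ : ℕ∞) φ) (_ : HasCompactSupport φ)
        (_ : tsupport φ ⊆ Ioo 0 T),
        {w | ∫ t, deriv φ t • w.fst t ∂(timeMeasure T)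
          = -∫ t, φ t • w.snd t ∂(timeMeasure T)} := by
    ext w
    simp only [mem_iInter]
    exact Iff.rfl
  rw [this]
  refine isClosed_iInter fun φ => isClosed_iInter fun h1 => isClosed_iInter fun h2 =>
    isClosed_iInter fun _ => isClosed_eq ?_ ?_
  · exact (hcont _ (h1.continuous_deriv (by simp)) h2.deriv).comp
      (WithLp.prod_continuous_ofLp 2 _ _).fst
  · exact ((hcont _ h1.continuous h2).comp (WithLp.prod_continuous_ofLp 2 _ _).snd).neg

instance H1.completeSpace (T : ℝ) : CompleteSpace (H1 T) :=
  (H1.isClosed T).completeSpace_coe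

instance H1.separableSpace (T : ℝ) : TopologicalSpace.SeparableSpace (H1 T) := by
  have : Fact ((2 : ENNReal) ≠ ⊤) := ⟨by norm_num⟩
  have : SecondCountableTopology (Lp Plane 2 (timeMeasure T)) := Lp.SecondCountableTopology
  have : SecondCountableTopology
      (WithLp 2 (Lp Plane 2 (timeMeasure T) × Lp Plane 2 (timeMeasure T))) :=
    (WithLp.homeomorphProd 2 _ _).secondCountableTopology
  infer_instance

/-- The norm of a path is controlled by its starting point and its energy. -/
theorem H1.norm_sq_le {T : ℝ} (hT : 0 < T) (W : H1 T) :
    ‖W‖ ^ 2 ≤ T * (2 * ‖H1.rep W 0‖ ^ 2 + 2 * (T * H1.seminormSq W)) + H1.seminormSq W := by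
  rw [H1.norm_sq_eq, ← H1.seminormSq_eq, ← integral_rep_sq_eq, ← integral_timeMeasure_const hT]
  refine add_le_add_left (integral_mono_ae (H1.integrable_rep_sq W) (integrable_const _) ?_) _
  filter_upwards [ae_restrict_mem measurableSet_Ioo] with s hs
  have hs' := Ioo_subset_Icc_self hs
  have h2 := H1.norm_rep_sub_sq_le hT W ⟨le_rfl, hT.le⟩ hs'
  have h3 : |s - 0| * H1.seminormSq W ≤ T * H1.seminormSq W := by
    refine mul_le_mul_of_nonneg_right ?_ (H1.seminormSq_nonneg W)
    rw [sub_zero, abs_of_nonneg hs'.1]; exact hs'.2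
  have h4 : ‖H1.rep W s‖ ≤ ‖H1.rep W 0‖ + ‖H1.rep W s - H1.rep W 0‖ := by
    simpa using norm_add_le (H1.rep W 0) (H1.rep W s - H1.rep W 0)
  have h5 := pow_le_pow_left₀ (norm_nonneg _) h4 2
  nlinarith [sq_nonneg (‖H1.rep W 0‖ - ‖H1.rep W s - H1.rep W 0‖)]

/-- A sequence bounded in `H¹` whose representatives converge pointwise converges weakly. -/
theorem H1.tendsto_weakly_of_tendsto_rep {T : ℝ} (hT : 0 < T) {U : ℕ → H1 T} {W : H1 T} {B : ℝ}
    (hB : ∀ n, ‖U n‖ ≤ B)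
    (h : ∀ t ∈ Icc 0 T, Tendsto (fun n => H1.rep (U n) t) atTop (𝓝 (H1.rep W t)))
    (f : StrongDual ℝ (H1 T)) : Tendsto (fun n => f (U n)) atTop (𝓝 (f W)) := by
  refine tendsto_of_subseq_tendsto fun ns hns => ?_
  obtain ⟨v, φ, hφ, hv⟩ := exists_subseq_tendsto_weakly (u := fun n => U (ns n)) fun n => hB _
  refine ⟨φ, ?_⟩
  have : W = v := by
    refine H1.ext_rep fun t ht => ?_
    exact tendsto_nhds_unique (((h t ht).comp hns).comp hφ.tendsto_atTop)
      (H1.tendsto_rep hT hv ht)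
  rw [this]
  exact hv f

/-! ### Step functions on the pixel grid -/

section Steps

variable {E : Type*} [NormedAddCommGroup E]

theorem floor_grid_eq {T : ℝ} (hT : 0 < T) {N : ℕ} (hN : 0 < N) {i : ℕ} {t : ℝ} :
    (0 ≤ t ∧ ⌊t * N / T⌋₊ = i) ↔ t ∈ Ico (i * T / N : ℝ) ((i + 1) * T / N) := by
  have hN' : (0 : ℝ) < N := by exact_mod_cast hN
  rw [mem_Ico, div_le_iff₀ hN', lt_div_iff₀ hN']
  constructor
  · rintro ⟨h0, h⟩
    rw [Nat.floor_eq_iff (by positivity), le_div_iff₀ hT, div_lt_iff₀ hT] at h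
    exact h
  · rintro ⟨h1, h2⟩
    have h0 : 0 ≤ t := by
      by_contra hneg
      have : t * N < 0 := mul_neg_of_neg_of_pos (not_le.1 hneg) hN'
      have : (0 : ℝ) ≤ i * T := by positivity
      linarith
    refine ⟨h0, ?_⟩
    rw [Nat.floor_eq_iff (by positivity), le_div_iff₀ hT, div_lt_iff₀ hT]
    exact ⟨h1, h2⟩

theorem floor_grid_lt {T : ℝ} (hT : 0 < T) {N : ℕ} (hN : 0 < N) {t : ℝ} (ht : t ∈ Ico 0 T) :
    ⌊t * N / T⌋₊ < N := by
  have hN' : (0 : ℝ) < N := by exact_mod_cast hN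
  have h0 := ht.1
  rw [Nat.floor_lt (by positivity), div_lt_iff₀ hT, mul_comm]
  exact mul_lt_mul_of_pos_left ht.2 hN'

theorem stronglyMeasurable_step (T : ℝ) (N : ℕ) (h : ℕ → E) :
    StronglyMeasurable fun t : ℝ => h ⌊t * N / T⌋₊ :=
  StronglyMeasurable.of_discrete.comp_measurable (g := fun t : ℝ => ⌊t * N / T⌋₊)
    (Nat.measurable_floor.comp (by fun_prop))

theorem norm_step_le {T : ℝ} (hT : 0 < T) (N : ℕ) (h : ℕ → E) (b : ℝ) :
    ∃ B, ∀ t ≤ b, ‖h ⌊t * N / T⌋₊‖ ≤ B := by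
  refine ⟨∑ j ∈ Finset.range (⌊b * N / T⌋₊ + 1), ‖h j‖, fun t ht => ?_⟩
  refine Finset.single_le_sum (f := fun j => ‖h j‖) (fun j _ => norm_nonneg _) ?_
  rw [Finset.mem_range, Nat.lt_succ_iff]
  exact Nat.floor_mono (by gcongr)

theorem intervalIntegrable_step {T : ℝ} (hT : 0 < T) (N : ℕ) (h : ℕ → E) (a b : ℝ) :
    IntervalIntegrable (fun t : ℝ => h ⌊t * N / T⌋₊) volume a b := by
  obtain ⟨B, hB⟩ := norm_step_le hT N h (max a b)
  rw [intervalIntegrable_iff]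
  refine Measure.integrableOn_of_bounded (by simp)
    (stronglyMeasurable_step T N h).aestronglyMeasurable (M := B) ?_
  filter_upwards [ae_restrict_mem measurableSet_uIoc] with t ht
  exact hB t ht.2

variable [NormedSpace ℝ E] [CompleteSpace E]

theorem integral_step_part {T : ℝ} (hT : 0 < T) {N : ℕ} (hN : 0 < N) (h : ℕ → E) (i : ℕ) {s : ℝ}
    (hs : s ∈ Icc (0 : ℝ) 1) :
    ∫ t in (i * T / N : ℝ)..((i + s) * T / N), h ⌊t * N / T⌋₊ = (s * (T / N)) • h i := by
  have hN' : (0 : ℝ) < N := by exact_mod_cast hN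
  have hle : (i * T / N : ℝ) ≤ (i + s) * T / N := by
    have := hs.1
    gcongr; linarith
  have hle' : ((i + s) * T / N : ℝ) ≤ (i + 1) * T / N := by
    have := hs.2
    gcongr
  have : ∫ t in (i * T / N : ℝ)..((i + s) * T / N), h ⌊t * N / T⌋₊
      = ∫ t in (i * T / N : ℝ)..((i + s) * T / N), h i := by
    rw [intervalIntegral.integral_of_le hle, intervalIntegral.integral_of_le hle,
      integral_Ioc_eq_integral_Ioo, integral_Ioc_eq_integral_Ioo]
    refine setIntegral_congr_fun measurableSet_Ioo fun t ht => ?_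
    have := ((floor_grid_eq hT hN).2 ⟨ht.1.le, ht.2.trans_le hle'⟩).2
    simp only [this]
  rw [this, intervalIntegral.integral_const]
  congr 1
  ring

theorem integral_step {T : ℝ} (hT : 0 < T) {N : ℕ} (hN : 0 < N) (h : ℕ → E) (n : ℕ) :
    ∫ t in (0 : ℝ)..(n * T / N), h ⌊t * N / T⌋₊ = ∑ j ∈ Finset.range n, (T / N) • h j := by
  induction n with
  | zero => simp
  | succ n ih =>
    rw [Finset.sum_range_succ, ← ih, ← intervalIntegral.integral_add_adjacent_intervals
      (intervalIntegrable_step hT N h _ (n * T / N)) (intervalIntegrable_step hT N h _ _)]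
    have := integral_step_part hT hN h n (s := 1) ⟨zero_le_one, le_rfl⟩
    rw [one_mul] at this
    rw [← this, Nat.cast_succ]

theorem integral_step_total {T : ℝ} (hT : 0 < T) {N : ℕ} (hN : 0 < N) (h : ℕ → E) :
    ∫ t in (0 : ℝ)..T, h ⌊t * N / T⌋₊ = ∑ j ∈ Finset.range N, (T / N) • h j := by
  have hN' : (N : ℝ) ≠ 0 := by exact_mod_cast hN.ne'
  rw [← integral_step hT hN h N, mul_div_cancel_left₀ _ hN']

end Steps

theorem grid_mem_Icc {T : ℝ} (hT : 0 < T) {N : ℕ} (hN : 0 < N) {a : ℝ} (h0 : 0 ≤ a)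
    (h1 : a ≤ N) : a * T / N ∈ Icc 0 T := by
  have hN' : (0 : ℝ) < N := by exact_mod_cast hN
  refine ⟨by positivity, ?_⟩
  rw [div_le_iff₀ hN', mul_comm]
  gcongr

theorem exists_grid_coord {T : ℝ} (hT : 0 < T) {N : ℕ} (hN : 0 < N) {t : ℝ} (ht : t ∈ Icc 0 T) :
    ∃ i < N, ∃ s ∈ Icc (0 : ℝ) 1, t = (i + s) * T / N := by
  have hN' : (0 : ℝ) < N := by exact_mod_cast hN
  rcases ht.2.eq_or_lt with rfl | hlt
  · refine ⟨N - 1, Nat.sub_lt hN one_pos, 1, ⟨zero_le_one, le_rfl⟩, ?_⟩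
    rw [Nat.cast_pred hN, sub_add_cancel, mul_div_cancel_left₀ _ hN'.ne']
  · refine ⟨⌊t * N / T⌋₊, floor_grid_lt hT hN ⟨ht.1, hlt⟩, t * N / T - ⌊t * N / T⌋₊, ⟨?_, ?_⟩, ?_⟩
    · have h0 := ht.1
      exact sub_nonneg.2 (Nat.floor_le (by positivity))
    · linarith [Nat.lt_floor_add_one (t * N / T)]
    · field_simp
      ring

/-! ### Piecewise affine interpolation -/

/-- The velocity of the piecewise affine interpolation of `f` on the `i`-th grid interval. -/
noncomputable def gridSlope (T : ℝ) (N : ℕ) (f : ℝ → Plane) (i : ℕ) : Plane :=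
  (N / T) • (f ((i + 1) * T / N) - f (i * T / N))

theorem memLp_gridSlope {T : ℝ} (hT : 0 < T) (N : ℕ) (f : ℝ → Plane) :
    MemLp (fun t : ℝ => gridSlope T N f ⌊t * N / T⌋₊) 2 (timeMeasure T) := by
  obtain ⟨B, hB⟩ := norm_step_le hT N (gridSlope T N f) T
  refine MemLp.of_bound (stronglyMeasurable_step T N _).aestronglyMeasurable B ?_
  filter_upwards [ae_restrict_mem measurableSet_Ioo] with t ht
  exact hB t ht.2.le

/-- The piecewise affine interpolation of `f` at the grid times `iT/N`, as an element of `H¹`. -/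
noncomputable def H1.interp {T : ℝ} (hT : 0 < T) (N : ℕ) (f : ℝ → Plane) : H1 T :=
  (H1.exists_mk hT (f 0) (memLp_gridSlope hT N f)).choose

theorem H1.interp_snd {T : ℝ} (hT : 0 < T) (N : ℕ) (f : ℝ → Plane) :
    (H1.interp hT N f).1.snd =ᵐ[timeMeasure T] fun t => gridSlope T N f ⌊t * N / T⌋₊ :=
  (H1.exists_mk hT (f 0) (memLp_gridSlope hT N f)).choose_spec.1

theorem H1.rep_interp {T : ℝ} (hT : 0 < T) {N : ℕ} (hN : 0 < N) (f : ℝ → Plane) {i : ℕ}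
    (hi : i < N) {s : ℝ} (hs : s ∈ Icc (0 : ℝ) 1) :
    H1.rep (H1.interp hT N f) ((i + s) * T / N)
      = (1 - s) • f (i * T / N) + s • f ((i + 1) * T / N) := by
  have hN' : (0 : ℝ) < N := by exact_mod_cast hN
  have hi' : (i : ℝ) + 1 ≤ N := by exact_mod_cast hi
  have hs0 := hs.1
  have hs1 := hs.2
  have hmem : (i + s) * T / N ∈ Icc 0 T := grid_mem_Icc hT hN (by positivity) (by linarith)
  have hrep := (H1.exists_mk hT (f 0) (memLp_gridSlope hT N f)).choose_spec.2 _ hmem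
  have hNT : (T / N : ℝ) * (N / T) = 1 := by field_simp
  have hsum : ∑ j ∈ Finset.range i, (T / N : ℝ) • gridSlope T N f j
      = f (i * T / N) - f 0 := by
    have := Finset.sum_range_sub (fun j : ℕ => f (j * T / N)) i
    simp only [Nat.cast_zero, zero_mul, zero_div] at this
    rw [← this]
    refine Finset.sum_congr rfl fun j _ => ?_
    rw [gridSlope, smul_smul, hNT, one_smul, Nat.cast_succ]
  rw [H1.interp, hrep, ← intervalIntegral.integral_add_adjacent_intervals
    (intervalIntegrable_step hT N _ _ (i * T / N)) (intervalIntegrable_step hT N _ _ _),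
    integral_step hT hN, integral_step_part hT hN _ i hs, hsum, gridSlope, smul_smul, mul_assoc,
    hNT, mul_one, smul_sub, sub_smul, one_smul]
  abel

theorem H1.rep_interp_grid {T : ℝ} (hT : 0 < T) {N : ℕ} (hN : 0 < N) (f : ℝ → Plane) {i : ℕ}
    (hi : i ≤ N) : H1.rep (H1.interp hT N f) (i * T / N) = f (i * T / N) := by
  rcases hi.eq_or_lt with rfl | hlt
  · obtain ⟨k, rfl⟩ := Nat.exists_eq_succ_of_ne_zero hN.ne'
    have := H1.rep_interp hT hN f (Nat.lt_succ_self k) (s := 1) ⟨zero_le_one, le_rfl⟩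
    simpa using this
  · have := H1.rep_interp hT hN f hlt (s := 0) ⟨le_rfl, zero_le_one⟩
    simpa using this

theorem H1.rep_interp_zero {T : ℝ} (hT : 0 < T) {N : ℕ} (hN : 0 < N) (f : ℝ → Plane) :
    H1.rep (H1.interp hT N f) 0 = f 0 := by
  simpa using H1.rep_interp_grid hT hN f (Nat.zero_le N)

theorem H1.isPiecewiseAffine_interp {T : ℝ} (hT : 0 < T) {N : ℕ} (hN : 0 < N) (f : ℝ → Plane) :
    IsPiecewiseAffine T N (H1.rep (H1.interp hT N f)) := by
  intro i hi s hs
  have h1 := H1.rep_interp_grid hT hN f hi.le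
  have h2 := H1.rep_interp_grid hT hN f (Nat.succ_le_of_lt hi)
  rw [Nat.cast_succ] at h2
  rw [H1.rep_interp hT hN f hi hs, h1, h2]

theorem H1.eq_interp_of_isPiecewiseAffine {T : ℝ} (hT : 0 < T) {N : ℕ} (hN : 0 < N) {W : H1 T}
    (h : IsPiecewiseAffine T N (H1.rep W)) : W = H1.interp hT N (H1.rep W) := by
  refine H1.ext_rep fun t ht => ?_
  obtain ⟨i, hi, s, hs, rfl⟩ := exists_grid_coord hT hN ht
  rw [H1.rep_interp hT hN _ hi hs]
  exact h i hi s hs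

/-- The energy of a piecewise affine path is its discrete kinetic energy. -/
theorem H1.seminormSq_interp {T : ℝ} (hT : 0 < T) {N : ℕ} (hN : 0 < N) (f : ℝ → Plane) :
    H1.seminormSq (H1.interp hT N f)
      = ∑ i ∈ Finset.range N, ‖f ((i + 1) * T / N) - f (i * T / N)‖ ^ 2 / (T / N) := by
  have hN' : (0 : ℝ) < N := by exact_mod_cast hN
  have h1 : H1.seminormSq (H1.interp hT N f)
      = ∫ t in (0 : ℝ)..T, ‖gridSlope T N f ⌊t * N / T⌋₊‖ ^ 2 := by
    rw [intervalIntegral.integral_of_le hT.le, integral_Ioc_eq_integral_Ioo]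
    refine integral_congr_ae ?_
    filter_upwards [H1.interp_snd hT N f] with t ht
    rw [ht]
  rw [h1, integral_step_total hT hN fun i => ‖gridSlope T N f i‖ ^ 2]
  refine Finset.sum_congr rfl fun i _ => ?_
  rw [gridSlope, norm_smul, Real.norm_of_nonneg (by positivity), smul_eq_mul]
  field_simp

/-- Interpolation does not increase the energy. -/
theorem H1.seminormSq_interp_le {T : ℝ} (hT : 0 < T) {N : ℕ} (hN : 0 < N) (W : H1 T) :
    H1.seminormSq (H1.interp hT N (H1.rep W)) ≤ H1.seminormSq W := by
  have hN' : (0 : ℝ) < N := by exact_mod_cast hN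
  rw [H1.seminormSq_interp hT hN]
  have hmem : ∀ i : ℕ, i ≤ N → (i * T / N : ℝ) ∈ Icc 0 T := fun i hi =>
    grid_mem_Icc hT hN (by positivity) (by exact_mod_cast hi)
  have hle : ∀ i ∈ Finset.range N, ‖H1.rep W ((i + 1) * T / N) - H1.rep W (i * T / N)‖ ^ 2 / (T / N)
      ≤ ∫ t in ((i : ℕ) * T / N : ℝ)..((i + 1 : ℕ) * T / N), ‖W.1.snd t‖ ^ 2 := by
    intro i hi
    rw [Finset.mem_range] at hi
    have m1 := hmem i hi.le
    have m2 := hmem (i + 1) hi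
    have hst : (i * T / N : ℝ) ≤ (i + 1 : ℕ) * T / N := by
      push_cast
      gcongr; linarith
    rw [div_le_iff₀ (by positivity)]
    have := norm_intervalIntegral_sq_le hst
      (intervalIntegrable_of_timeMeasure (H1.integrable_snd W) m1 m2)
      (intervalIntegrable_of_timeMeasure (H1.integrable_snd_sq W) m1 m2)
    rw [← H1.rep_sub hT W m1 m2] at this
    push_cast at this ⊢
    refine this.trans (le_of_eq ?_)
    ring
  refine (Finset.sum_le_sum hle).trans (le_of_eq ?_)
  rw [intervalIntegral.sum_integral_adjacent_intervals (a := fun i : ℕ => (i * T / N : ℝ))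
    fun i hi => intervalIntegrable_of_timeMeasure (H1.integrable_snd_sq W) (hmem i hi.le)
      (hmem (i + 1) hi)]
  rw [Nat.cast_zero, zero_mul, zero_div, mul_div_cancel_left₀ _ hN'.ne',
    intervalIntegral.integral_of_le hT.le, integral_Ioc_eq_integral_Ioo]
  rfl

/-- The interpolations of an `H¹` path on ever finer grids converge to it weakly. -/
theorem H1.tendsto_interp {T : ℝ} (hT : 0 < T) {N : ℕ → ℕ} (hN : ∀ n, 0 < N n)
    (hlim : Tendsto N atTop atTop) (W : H1 T) (f : StrongDual ℝ (H1 T)) :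
    Tendsto (fun n => f (H1.interp hT (N n) (H1.rep W))) atTop (𝓝 (f W)) := by
  set S := H1.seminormSq W with hS
  have hS0 : 0 ≤ S := H1.seminormSq_nonneg W
  have hbd : ∀ n, ‖H1.interp hT (N n) (H1.rep W)‖
      ≤ √(T * (2 * ‖H1.rep W 0‖ ^ 2 + 2 * (T * S)) + S) := by
    intro n
    refine Real.le_sqrt_of_sq_le ((H1.norm_sq_le hT _).trans ?_)
    rw [H1.rep_interp_zero hT (hN n)]
    have := H1.seminormSq_interp_le hT (hN n) W
    gcongr
  refine H1.tendsto_weakly_of_tendsto_rep hT hbd (fun t ht => ?_) f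
  have hNr : Tendsto (fun n => ((N n : ℕ) : ℝ)) atTop atTop :=
    tendsto_natCast_atTop_atTop.comp hlim
  have hz : Tendsto (fun n => 2 * √(T / N n * S)) atTop (𝓝 0) := by
    have h1 : Tendsto (fun n => T / (N n : ℝ) * S) atTop (𝓝 (0 * S)) :=
      (tendsto_const_nhds.div_atTop hNr).mul_const S
    have := ((Real.continuous_sqrt.tendsto _).comp h1).const_mul 2
    simpa using this
  refine tendsto_iff_norm_sub_tendsto_zero.2
    (squeeze_zero (fun n => norm_nonneg _) (fun n => ?_) hz)
  obtain ⟨i, hi, s, hs, hts⟩ := exists_grid_coord hT (hN n) ht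
  have hN' : (0 : ℝ) < N n := by exact_mod_cast hN n
  have hm : (i * T / N n : ℝ) ∈ Icc 0 T :=
    grid_mem_Icc hT (hN n) (by positivity) (by exact_mod_cast hi.le)
  have hdist : |t - i * T / N n| ≤ T / N n := by
    have : t - i * T / N n = s * (T / N n) := by rw [hts]; ring
    rw [this, abs_of_nonneg (mul_nonneg hs.1 (by positivity))]
    exact mul_le_of_le_one_left (by positivity) hs.2
  have e1 := H1.norm_rep_sub_le hT W hm ht
  have e2 := H1.norm_rep_sub_le hT (H1.interp hT (N n) (H1.rep W)) hm ht
  rw [H1.rep_interp_grid hT (hN n) _ hi.le] at e2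
  have e1' : √(|t - i * T / N n| * H1.seminormSq W) ≤ √(T / N n * S) := by
    apply Real.sqrt_le_sqrt; gcongr
  have e2' : √(|t - i * T / N n| * H1.seminormSq (H1.interp hT (N n) (H1.rep W)))
      ≤ √(T / N n * S) := by
    apply Real.sqrt_le_sqrt
    have := H1.seminormSq_interp_le hT (hN n) W
    have h0 := H1.seminormSq_nonneg (H1.interp hT (N n) (H1.rep W))
    gcongr
  calc ‖H1.rep (H1.interp hT (N n) (H1.rep W)) t - H1.rep W t‖
      = ‖(H1.rep (H1.interp hT (N n) (H1.rep W)) t - H1.rep W (i * T / N n))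
        - (H1.rep W t - H1.rep W (i * T / N n))‖ := by rw [sub_sub_sub_cancel_right]
    _ ≤ _ := (norm_sub_le _ _).trans (by linarith)

/-! ### Asymptotics of the data dissimilarity -/

/-- A series dominated on both sides of the index `k` by a geometric sequence of small ratio is
essentially its `k`-th term. -/
theorem tsum_between_of_geometric {a : ℕ → ℝ} (ha : ∀ k, 0 ≤ a k) {k : ℕ} {q : ℝ} (hq0 : 0 ≤ q)
    (hq : q ≤ 1 / 2) (hup : ∀ j, a (k + j) ≤ a k * q ^ j)
    (hdown : ∀ m ≤ k, a (k - m) ≤ a k * q ^ m) :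
    a k ≤ ∑' j, a j ∧ ∑' j, a j ≤ a k * (1 + 4 * q) := by
  have hq1 : q < 1 := by linarith
  have hgs : Summable fun j => a k * q ^ j := (summable_geometric_of_lt_one hq0 hq1).mul_left _
  have hs' : Summable fun j => a (j + k) :=
    Summable.of_nonneg_of_le (fun j => ha _) (fun j => by rw [add_comm]; exact hup j) hgs
  have hs : Summable a := (summable_nat_add_iff k).1 hs'
  refine ⟨hs.le_tsum k fun j _ => ha j, ?_⟩
  rw [← hs.sum_add_tsum_nat_add k]
  have h1 : ∑' j, a (j + k) ≤ a k * (1 - q)⁻¹ := by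
    rw [← tsum_geometric_of_lt_one hq0 hq1, ← tsum_mul_left]
    exact hs'.tsum_le_tsum (fun j => by rw [add_comm]; exact hup j) hgs
  have h2 : ∑ j ∈ Finset.range k, a j ≤ a k * (q * (1 - q)⁻¹) := by
    rw [← Finset.sum_range_reflect]
    have h3 : ∀ j ∈ Finset.range k, a (k - 1 - j) ≤ a k * (q * q ^ j) := by
      intro j hj
      rw [Finset.mem_range] at hj
      have := hdown (j + 1) hj
      rwa [pow_succ', show k - (j + 1) = k - 1 - j by omega] at this
    refine (Finset.sum_le_sum h3).trans ?_
    rw [← Finset.mul_sum, ← Finset.mul_sum]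
    refine mul_le_mul_of_nonneg_left (mul_le_mul_of_nonneg_left ?_ hq0) (ha k)
    rw [← tsum_geometric_of_lt_one hq0 hq1]
    exact (summable_geometric_of_lt_one hq0 hq1).sum_le_tsum _ fun j _ => pow_nonneg hq0 j
  have h4 : q * (1 - q)⁻¹ + (1 - q)⁻¹ ≤ 1 + 4 * q := by
    have hpos : 0 < 1 - q := by linarith
    rw [← div_eq_mul_inv, ← one_div, ← add_div, div_le_iff₀ hpos]
    nlinarith
  nlinarith [mul_le_mul_of_nonneg_left h4 (ha k)]

/-- If the signal is that of `k` electrons plus noise small compared to the gain, the mixture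
density is dominated by its `k`-th summand, up to a relative error of order
`exp (-α² / (4 σ²))`. -/
theorem abs_dissimilarity_sub_le {α μ σ r z : ℝ} {k : ℕ} (hα : 0 < α) (hσ : 0 < σ) (hz : 0 < z)
    (hr : |σ * r| ≤ α / 4) {q : ℝ} (hq : q ≤ 1 / 2)
    (hqz : (z + k / z) * Real.exp (-(α ^ 2 / (4 * σ ^ 2))) ≤ q) :
    |dissimilarity α μ σ (α * k + (μ + σ * r)) z
      - (z - k * Real.log z + Real.log k.factorial + Real.log (√(2 * Real.pi) * σ) + r ^ 2 / 2)|
      ≤ 4 * q := by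
  set E := Real.exp (-(α ^ 2 / (4 * σ ^ 2))) with hE
  have hE0 : 0 < E := Real.exp_pos _
  have hq1 : z * E ≤ q := by
    refine le_trans ?_ hqz
    gcongr
    exact le_add_of_nonneg_right (by positivity)
  have hq2 : k / z * E ≤ q := by
    refine le_trans ?_ hqz
    gcongr
    exact le_add_of_nonneg_left hz.le
  have hq0 : 0 ≤ q := le_trans (by positivity) hq1
  set G : ℝ → ℝ := fun y => 1 / (√(2 * Real.pi) * σ)
    * Real.exp (-(α * k + (μ + σ * r) - α * y - μ) ^ 2 / (2 * σ ^ 2)) with hG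
  have hG0 : ∀ y, 0 < G y := fun y => by positivity
  set a : ℕ → ℝ := fun j => z ^ j * Real.exp (-z) / (j.factorial : ℝ) * G j with ha
  have ha0 : ∀ j, 0 < a j := fun j => mul_pos (by positivity) (hG0 _)
  have hGk : G k = 1 / (√(2 * Real.pi) * σ) * Real.exp (-(r ^ 2 / 2)) := by
    simp only [hG]
    congr 2
    field_simp
    ring
  -- the Gaussian factor decays geometrically with the distance to `k`
  have hGauss : ∀ (j : ℕ) (y : ℝ), |y - k| = j → G y ≤ G k * E ^ j := by
    intro j y hy
    rw [hGk, hE, ← Real.exp_nat_mul, mul_assoc, ← Real.exp_add]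
    refine mul_le_mul_of_nonneg_left (Real.exp_le_exp.2 ?_) (by positivity)
    have hσ2 : 0 < 2 * σ ^ 2 := by positivity
    rw [div_le_iff₀ hσ2]
    have e : (-(r ^ 2 / 2) + (j : ℝ) * -(α ^ 2 / (4 * σ ^ 2))) * (2 * σ ^ 2)
        = -(σ * r) ^ 2 - j * α ^ 2 / 2 := by
      field_simp
      ring
    rw [e]
    have hj2 : (y - k) ^ 2 = (j : ℝ) ^ 2 := by rw [← hy, sq_abs]
    have hjj : (j : ℝ) ≤ (j : ℝ) ^ 2 := by
      exact_mod_cast Nat.le_self_pow two_ne_zero j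
    have hcross : (σ * r) * (y - k) ≤ α / 4 * j := by
      calc (σ * r) * (y - k) ≤ |(σ * r) * (y - k)| := le_abs_self _
        _ = |σ * r| * j := by rw [abs_mul, hy]
        _ ≤ _ := by gcongr
    have e2 : -(α * k + (μ + σ * r) - α * y - μ) ^ 2
        = -(σ * r) ^ 2 + 2 * α * ((σ * r) * (y - k)) - α ^ 2 * (y - k) ^ 2 := by ring
    rw [e2, hj2]
    have := mul_le_mul_of_nonneg_left hcross (by positivity : (0 : ℝ) ≤ 2 * α)
    have := mul_le_mul_of_nonneg_left hjj (by positivity : (0 : ℝ) ≤ α ^ 2)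
    nlinarith
  have hup : ∀ j, a (k + j) ≤ a k * q ^ j := by
    intro j
    have h1 : G ((k + j : ℕ) : ℝ) ≤ G k * E ^ j := hGauss j _ (by push_cast; simp)
    have h2 : z ^ (k + j) * Real.exp (-z) / ((k + j).factorial : ℝ)
        ≤ z ^ k * Real.exp (-z) / (k.factorial : ℝ) * z ^ j := by
      rw [div_mul_eq_mul_div, pow_add, mul_right_comm]
      have : (k.factorial : ℝ) ≤ (k + j).factorial := by
        exact_mod_cast Nat.factorial_le (Nat.le_add_right k j)
      gcongr
    calc a (k + j) ≤ (z ^ k * Real.exp (-z) / (k.factorial : ℝ) * z ^ j) * (G k * E ^ j) :=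
          mul_le_mul h2 h1 (hG0 _).le (by positivity)
      _ = a k * (z * E) ^ j := by simp only [ha]; rw [mul_pow]; ring
      _ ≤ a k * q ^ j := by
          have := (ha0 k).le
          gcongr
  have hdown : ∀ m ≤ k, a (k - m) ≤ a k * q ^ m := by
    intro m hm
    have h1 : G ((k - m : ℕ) : ℝ) ≤ G k * E ^ m := hGauss m _ (by
      rw [Nat.cast_sub hm]; simp)
    have h2 : z ^ (k - m) * Real.exp (-z) / ((k - m).factorial : ℝ)
        ≤ z ^ k * Real.exp (-z) / (k.factorial : ℝ) * (k / z) ^ m := by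
      have hf : (k.factorial : ℝ) = (k - m).factorial * k.descFactorial m := by
        exact_mod_cast (Nat.factorial_mul_descFactorial hm).symm
      have hd : (k.descFactorial m : ℝ) ≤ (k : ℝ) ^ m := by
        exact_mod_cast Nat.descFactorial_le_pow k m
      have hz' : z ^ k = z ^ (k - m) * z ^ m := by rw [← pow_add, Nat.sub_add_cancel hm]
      have hd0 : (0 : ℝ) < k.descFactorial m := by
        exact_mod_cast Nat.pos_of_ne_zero (fun h => by
          rw [Nat.descFactorial_eq_zero_iff_lt] at h; omega)
      rw [hf, hz', div_pow]
      have e : z ^ (k - m) * z ^ m * Real.exp (-z) / (((k - m).factorial : ℝ) * k.descFactorial m)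
          * ((k : ℝ) ^ m / z ^ m) = z ^ (k - m) * Real.exp (-z) / ((k - m).factorial : ℝ)
            * ((k : ℝ) ^ m / k.descFactorial m) := by
        field_simp
      rw [e]
      exact le_mul_of_one_le_right (by positivity) ((one_le_div hd0).2 hd)
    calc a (k - m) ≤ (z ^ k * Real.exp (-z) / (k.factorial : ℝ) * (k / z) ^ m) * (G k * E ^ m) :=
          mul_le_mul h2 h1 (hG0 _).le (by positivity)
      _ = a k * (k / z * E) ^ m := by simp only [ha]; rw [mul_pow]; ring
      _ ≤ a k * q ^ m := by
          have := (ha0 k).le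
          gcongr
  obtain ⟨hl, hu⟩ := tsum_between_of_geometric (fun j => (ha0 j).le) hq0 hq hup hdown
  have hlog : Real.log (a k) = -(z - k * Real.log z + Real.log k.factorial
      + Real.log (√(2 * Real.pi) * σ) + r ^ 2 / 2) := by
    have hs : √(2 * Real.pi) * σ ≠ 0 := by positivity
    simp only [ha]
    rw [Real.log_mul (by positivity) (hG0 _).ne', hGk, Real.log_div (by positivity) (by positivity),
      Real.log_mul (by positivity) (by positivity), Real.log_pow, Real.log_exp,
      Real.log_mul (by positivity) (by positivity), Real.log_exp, one_div, Real.log_inv]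
    ring
  have hd : dissimilarity α μ σ (α * k + (μ + σ * r)) z = -Real.log (∑' j, a j) := rfl
  have hup' : Real.log (∑' j, a j) ≤ Real.log (a k) + 4 * q := by
    have h4 : 0 < 1 + 4 * q := by linarith
    calc Real.log (∑' j, a j) ≤ Real.log (a k * (1 + 4 * q)) :=
          Real.log_le_log ((ha0 k).trans_le hl) hu
      _ = Real.log (a k) + Real.log (1 + 4 * q) := Real.log_mul (ha0 k).ne' h4.ne'
      _ ≤ _ := by linarith [Real.log_le_sub_one_of_pos h4]
  have hlow := Real.log_le_log (ha0 k) hl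
  rw [hd, abs_le]
  constructor <;> linarith

/-- The electron count read off a normalized signal value `G`: the integer nearest to `G Δt`. -/
noncomputable def readCount (T : ℝ) (N : ℕ) (G : ℝ) : ℕ := (round (G * (T / N))).toNat

/-- The part of the data term that does not depend on the reconstruction; it is computed from the
normalized signal and the noise level alone. -/
noncomputable def normalizationConstant (T α : ℝ) (N : ℕ) (G : Fin N → ℝ) (σ : ℝ) : ℝ :=
  ∑ i, (Real.log (readCount T N (G i)).factorial + Real.log (√(2 * Real.pi) * σ)
    + (α * (T / N) * G i - α * readCount T N (G i)) ^ 2 / (2 * σ ^ 2)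
    - readCount T N (G i) * Real.log (T / N))

theorem readCount_eq {T α μ σ r : ℝ} {N k : ℕ} (hT : 0 < T) (hα : 0 < α) (hN : 0 < N)
    (hr : |σ * r| ≤ α / 4) :
    readCount T N ((α * k + (μ + σ * r) - μ) / (α * (T / N))) = k := by
  have hN' : (0 : ℝ) < N := by exact_mod_cast hN
  have e : (α * k + (μ + σ * r) - μ) / (α * (T / N)) * (T / N) = k + σ * r / α := by
    field_simp
    ring
  rw [readCount, e, round_eq]
  have : ⌊(k : ℝ) + σ * r / α + 1 / 2⌋ = (k : ℤ) := by
    rw [abs_le] at hr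
    have h1 : -(1 / 4) ≤ σ * r / α := by rw [le_div_iff₀ hα]; linarith
    have h2 : σ * r / α ≤ 1 / 4 := by rw [div_le_iff₀ hα]; linarith
    rw [Int.floor_eq_iff]
    push_cast
    constructor <;> linarith
  rw [this, Int.toNat_natCast]

theorem abs_sum_dissimilarity_sub_le {T α μ σ : ℝ} {N : ℕ} (hT : 0 < T) (hα : 0 < α) (hN : 0 < N)
    (hσ : 0 < σ) {k : Fin N → ℕ} {r u g : Fin N → ℝ} (hu : ∀ i, 0 < u i)
    (hr : ∀ i, |σ * r i| ≤ α / 4) (hg : ∀ i, g i = α * k i + (μ + σ * r i))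
    {q : ℝ} (hq : q ≤ 1 / 2)
    (hqz : ∀ i, (T / N * u i + k i / (T / N * u i)) * Real.exp (-(α ^ 2 / (4 * σ ^ 2))) ≤ q) :
    |∑ i, dissimilarity α μ σ (g i) (T / N * u i)
      - normalizationConstant T α N (normalizedSignal T α μ g) σ
      - ∑ i, (T / N * u i - k i * Real.log (u i))| ≤ N * (4 * q) := by
  have hN' : (0 : ℝ) < N := by exact_mod_cast hN
  rw [normalizationConstant, ← Finset.sum_sub_distrib, ← Finset.sum_sub_distrib]
  refine (Finset.abs_sum_le_sum_abs _ _).trans ?_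
  have : ∀ i ∈ Finset.univ, |dissimilarity α μ σ (g i) (T / N * u i)
      - (Real.log (readCount T N (normalizedSignal T α μ g i)).factorial
        + Real.log (√(2 * Real.pi) * σ)
        + (α * (T / N) * normalizedSignal T α μ g i
          - α * readCount T N (normalizedSignal T α μ g i)) ^ 2 / (2 * σ ^ 2)
        - readCount T N (normalizedSignal T α μ g i) * Real.log (T / N))
      - (T / N * u i - k i * Real.log (u i))| ≤ 4 * q := by
    intro i _
    have hz : 0 < T / N * u i := mul_pos (by positivity) (hu i)
    have h := abs_dissimilarity_sub_le (μ := μ) hα hσ hz (hr i) hq (hqz i)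
    rw [normalizedSignal, hg i, readCount_eq hT hα hN (hr i)]
    have e : (α * (T / N) * ((α * k i + (μ + σ * r i) - μ) / (α * (T / N))) - α * k i) ^ 2
        / (2 * σ ^ 2) = r i ^ 2 / 2 := by
      field_simp
      ring
    rw [e]
    rw [Real.log_mul (by positivity) (hu i).ne'] at h
    refine le_trans (le_of_eq ?_) h
    congr 1
    ring
  refine (Finset.sum_le_sum this).trans (le_of_eq ?_)
  simp

theorem tendsto_mul_error_zero (a b : ℝ) :
    Tendsto (fun N : ℕ => (N : ℝ) * (4 * ((a / N + b * N) * Real.exp (-((N : ℝ) ^ 2 / 4)))))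
      atTop (𝓝 0) := by
  have hlim : Tendsto (fun x : ℝ => x ^ 2 / 4) atTop atTop :=
    (tendsto_pow_atTop two_ne_zero).atTop_div_const (by norm_num)
  have h0 : Tendsto (fun x : ℝ => Real.exp (-(x ^ 2 / 4))) atTop (𝓝 0) :=
    Real.tendsto_exp_neg_atTop_nhds_zero.comp hlim
  have h1 : Tendsto (fun x : ℝ => x ^ 2 / 4 * Real.exp (-(x ^ 2 / 4))) atTop (𝓝 0) := by
    have := (Real.tendsto_pow_mul_exp_neg_atTop_nhds_zero 1).comp hlim
    refine this.congr fun x => ?_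
    simp
  have h2 : Tendsto (fun x : ℝ => 4 * a * Real.exp (-(x ^ 2 / 4))
      + 16 * b * (x ^ 2 / 4 * Real.exp (-(x ^ 2 / 4)))) atTop (𝓝 0) := by
    simpa using (h0.const_mul (4 * a)).add (h1.const_mul (16 * b))
  refine (h2.comp tendsto_natCast_atTop_atTop).congr' ?_
  filter_upwards [eventually_gt_atTop 0] with N hN
  have hN' : (0 : ℝ) < N := by exact_mod_cast hN
  simp only [Function.comp]
  field_simp
  ring

/-! ### Almost sure properties of the data -/

/-- A Poisson point process almost surely has no point in a null set of its intensity. -/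
theorem IsUnitPoissonProcess.ae_inter_eq_empty {𝓞 : Type*} [MeasurableSpace 𝓞] {P : Measure 𝓞}
    {T : ℝ} {e : 𝓞 → PointConfig T} (he : IsUnitPoissonProcess P T e) {S : Set (ℝ × ℝ)}
    (hS : MeasurableSet S) (h0 : volume S = 0) : ∀ᵐ ω ∂P, (e ω).pts ∩ S = ∅ := by
  have hν : (volume.restrict (Icc 0 T ×ˢ Ici (0 : ℝ))) S = 0 :=
    le_antisymm ((Measure.restrict_le_self S).trans h0.le) bot_le
  have hlaw := he.law_count S hS (by rw [hν]; exact ENNReal.zero_ne_top)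
  have hm := he.measurable_count S hS
  rw [hν, ENNReal.toNNReal_zero] at hlaw
  have h1 : P.map (fun ω => ((e ω).pts ∩ S).encard) {0}ᶜ = 0 := by
    rw [hlaw, Measure.map_apply (by fun_prop) (measurableSet_singleton _).compl]
    have : (Nat.cast ⁻¹' ({0}ᶜ : Set ℕ∞) : Set ℕ) = {0}ᶜ := by
      ext n; simp
    rw [this]
    simp only [ProbabilityTheory.poissonMeasure]
    -- all summands but the zeroth vanish
    simp
    intro i
    rcases Nat.eq_zero_or_pos i with h | h
    · exact Or.inr h
    · rw [zero_pow h.ne', zero_div]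
      exact Or.inl le_rfl
  rw [Measure.map_apply hm (measurableSet_singleton _).compl] at h1
  have h2 : ∀ᵐ ω ∂P, ω ∉ (fun ω => ((e ω).pts ∩ S).encard) ⁻¹' {0}ᶜ :=
    measure_eq_zero_iff_ae_notMem.1 h1
  filter_upwards [h2] with ω hω
  simpa using hω

theorem volume_graph_eq_zero {f : ℝ → ℝ} (hf : Measurable f) :
    volume {q : ℝ × ℝ | q.2 = f q.1} = 0 := by
  have hm : MeasurableSet {q : ℝ × ℝ | q.2 = f q.1} :=
    measurableSet_eq_fun measurable_snd (hf.comp measurable_fst)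
  rw [Measure.volume_eq_prod, Measure.measure_prod_null hm]
  refine Eventually.of_forall fun x => ?_
  have : Prod.mk x ⁻¹' {q : ℝ × ℝ | q.2 = f q.1} = {f x} := by ext y; simp
  simp [this]

theorem volume_vertical_line_eq_zero (T : ℝ) : volume {q : ℝ × ℝ | q.1 = T} = 0 := by
  have : {q : ℝ × ℝ | q.1 = T} = {T} ×ˢ univ := by ext q; simp
  rw [this, Measure.volume_eq_prod, Measure.prod_prod]
  simp

theorem gaussian_tail_le : ∃ C : ℝ, ∀ ε : ℝ, 0 < ε →
    ProbabilityTheory.gaussianReal 0 1 {y | ε < |y|} ≤ ENNReal.ofReal (C / ε ^ 3) := by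
  refine ⟨∫ y, |y| ^ 3 ∂(ProbabilityTheory.gaussianReal 0 1), fun ε hε => ?_⟩
  have hint : Integrable (fun y : ℝ => |y| ^ 3) (ProbabilityTheory.gaussianReal 0 1) :=
    (ProbabilityTheory.memLp_id_gaussianReal (μ := 0) (v := 1) 3).integrable_norm_pow (by norm_num)
  have h := mul_meas_ge_le_integral_of_nonneg (Eventually.of_forall fun y : ℝ => by positivity)
    hint (ε ^ 3)
  have hsub : {y : ℝ | ε < |y|} ⊆ {y : ℝ | ε ^ 3 ≤ |y| ^ 3} := fun y hy =>
    pow_le_pow_left₀ hε.le (le_of_lt hy) 3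
  refine (measure_mono hsub).trans ?_
  rw [← ENNReal.ofReal_toReal (measure_ne_top (ProbabilityTheory.gaussianReal 0 1)
    {y : ℝ | ε ^ 3 ≤ |y| ^ 3})]
  refine ENNReal.ofReal_le_ofReal ?_
  rw [le_div_iff₀ (by positivity), mul_comm]
  exact h

/-- Almost surely, the noise at the `N` grid times is at most `N / 4` once `N` is large. -/
theorem IsGaussianWhiteNoise.ae_eventually_le {𝓞 : Type*} [MeasurableSpace 𝓞] {P : Measure 𝓞}
    {T : ℝ} (hT : 0 < T) {R : ℝ → 𝓞 → ℝ} (hR : IsGaussianWhiteNoise P T R) :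
    ∀ᵐ ω ∂P, ∀ᶠ N : ℕ in atTop, ∀ i < N, |R ((i + 1) * T / N) ω| ≤ N / 4 := by
  obtain ⟨C, hC⟩ := gaussian_tail_le
  set s : ℕ → Set 𝓞 := fun N => ⋃ i ∈ Finset.range N, {ω | (N : ℝ) / 4 < |R ((i + 1) * T / N) ω|}
    with hs
  have hbound : ∀ N, P (s N) ≤ ENNReal.ofReal (64 * C * (1 / (N : ℝ) ^ 2)) := by
    intro N
    rcases Nat.eq_zero_or_pos N with rfl | hN
    · simp [hs]
    have hN' : (0 : ℝ) < N := by exact_mod_cast hN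
    calc P (s N) ≤ ∑ i ∈ Finset.range N, P {ω | (N : ℝ) / 4 < |R ((i + 1) * T / N) ω|} :=
          measure_biUnion_finset_le _ _
      _ ≤ ∑ i ∈ Finset.range N, ENNReal.ofReal (C / ((N : ℝ) / 4) ^ 3) := by
          refine Finset.sum_le_sum fun i hi => ?_
          rw [Finset.mem_range] at hi
          have hmem : (i + 1) * T / N ∈ Icc 0 T :=
            grid_mem_Icc hT hN (by positivity) (by exact_mod_cast hi)
          refine le_trans (le_of_eq ?_) (hC ((N : ℝ) / 4) (by positivity))
          rw [← hR.law _ hmem, Measure.map_apply (hR.measurable _ hmem)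
            (measurableSet_lt measurable_const (by fun_prop))]
          rfl
      _ = ENNReal.ofReal (64 * C * (1 / (N : ℝ) ^ 2)) := by
          rw [Finset.sum_const, Finset.card_range, nsmul_eq_mul, ← ENNReal.ofReal_natCast,
            ← ENNReal.ofReal_mul hN'.le]
          congr 1
          field_simp
          norm_num
  have hsum : ∑' N, P (s N) ≠ ⊤ := by
    have hsm : Summable fun N : ℕ => 64 * C * (1 / (N : ℝ) ^ 2) :=
      (Real.summable_one_div_nat_pow.2 one_lt_two).mul_left _
    exact ne_top_of_le_ne_top hsm.tsum_ofReal_ne_top (ENNReal.tsum_le_tsum hbound)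
  filter_upwards [ae_eventually_notMem hsum] with ω hω
  filter_upwards [hω] with N hN i hi
  by_contra hlt
  exact hN (mem_biUnion (Finset.mem_range.2 hi) (not_le.1 hlt))

theorem electronMeasure_eq_sum {T : ℝ} {e : PointConfig T} {lam : ℝ → ℝ} {Q : Finset (ℝ × ℝ)}
    (hQ : ∀ q, q ∈ Q ↔ q ∈ e.pts ∧ q.2 ≤ lam q.1) :
    electronMeasure e lam = ∑ q ∈ Q, Measure.dirac q.1 := by
  have hset : {q : ℝ × ℝ | q ∈ e.pts ∧ q.2 ≤ lam q.1} = ↑Q := by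
    ext q; exact (hQ q).symm
  have h1 : electronMeasure e lam
      = Measure.sum fun q : {q : ℝ × ℝ | q ∈ e.pts ∧ q.2 ≤ lam q.1} =>
        Measure.dirac (q : ℝ × ℝ).1 := rfl
  rw [h1, hset]
  exact Measure.sum_coe_finset Q fun q => Measure.dirac q.1

/-- Off the exceptional null sets, the electron measures of uniformly bounded, pointwise convergent
intensities are eventually constant: only finitely many points of the configuration matter, and
none of them lies on the graph of the limit intensity. -/
theorem exists_electronMeasure_eventually_eq {T : ℝ} {e : PointConfig T} {lam : ℕ → ℝ → ℝ}
    {laminf : ℝ → ℝ} {L : ℝ} (hend : ∀ q ∈ e.pts, q.1 ≠ T)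
    (hgraph : ∀ q ∈ e.pts, q.2 ≠ laminf q.1)
    (hlim : ∀ t ∈ Ico 0 T, Tendsto (fun n => lam n t) atTop (𝓝 (laminf t)))
    (hL : ∀ᶠ n in atTop, ∀ t ∈ Ico 0 T, lam n t ≤ L) :
    ∃ Q : Finset (ℝ × ℝ), (∀ q ∈ Q, q.1 ∈ Ico 0 T) ∧
      electronMeasure e laminf = ∑ q ∈ Q, Measure.dirac q.1 ∧
      ∀ᶠ n in atTop, electronMeasure e (lam n) = ∑ q ∈ Q, Measure.dirac q.1 := by
  have hmem : ∀ q ∈ e.pts, q.1 ∈ Ico 0 T := fun q hq =>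
    ⟨(e.subset_strip hq).1.1, lt_of_le_of_ne (e.subset_strip hq).1.2 (hend q hq)⟩
  have hLinf : ∀ t ∈ Ico 0 T, laminf t ≤ L := fun t ht =>
    le_of_tendsto (hlim t ht) (hL.mono fun n hn => hn t ht)
  have hfin := e.finite_below L
  have hfinQ : {q : ℝ × ℝ | q ∈ e.pts ∧ q.2 ≤ laminf q.1}.Finite :=
    hfin.subset fun q hq => ⟨hq.1, hq.2.trans (hLinf _ (hmem q hq.1))⟩
  refine ⟨hfinQ.toFinset, ?_, electronMeasure_eq_sum fun q => hfinQ.mem_toFinset, ?_⟩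
  · intro q hq
    exact hmem q (hfinQ.mem_toFinset.1 hq).1
  have hside : ∀ᶠ n in atTop, ∀ q ∈ e.pts ∩ {q | q.2 ≤ L},
      (q.2 ≤ lam n q.1 ↔ q.2 ≤ laminf q.1) := by
    rw [eventually_all_finite hfin]
    intro q hq
    rcases lt_or_gt_of_ne (hgraph q hq.1) with h | h
    · filter_upwards [(hlim _ (hmem q hq.1)).eventually_const_lt h] with n hn
      exact ⟨fun _ => h.le, fun _ => hn.le⟩
    · filter_upwards [(hlim _ (hmem q hq.1)).eventually_lt_const h] with n hn
      exact ⟨fun h' => absurd h' (not_le.2 hn), fun h' => absurd h' (not_le.2 h)⟩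
  filter_upwards [hside, hL] with n h1 h2
  refine electronMeasure_eq_sum fun q => ?_
  rw [hfinQ.mem_toFinset]
  constructor
  · rintro ⟨a, b⟩
    exact ⟨a, (h1 q ⟨a, b.trans (hLinf _ (hmem q a))⟩).2 b⟩
  · rintro ⟨a, b⟩
    exact ⟨a, (h1 q ⟨a, b.trans (h2 _ (hmem q a))⟩).1 b⟩

theorem sum_dirac_real_eq_card (Q : Finset (ℝ × ℝ)) {B : Set ℝ} (hB : MeasurableSet B)
    [DecidablePred fun q : ℝ × ℝ => q.1 ∈ B] :
    (∑ q ∈ Q, Measure.dirac q.1 : Measure ℝ).real B = (Q.filter fun q => q.1 ∈ B).card := by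
  rw [Measure.real, Measure.finsetSum_apply]
  simp only [Measure.dirac_apply' _ hB]
  rw [ENNReal.toReal_sum (fun q _ => by by_cases h : q.1 ∈ B <;> simp [h]), Finset.card_filter]
  push_cast
  refine Finset.sum_congr rfl fun q _ => ?_
  by_cases h : q.1 ∈ B <;> simp [h]

theorem setIntegral_sum_dirac (Q : Finset (ℝ × ℝ)) {B : Set ℝ} (hB : MeasurableSet B)
    (hQ : ∀ q ∈ Q, q.1 ∈ B) (f : ℝ → ℝ) :
    ∫ t in B, f t ∂(∑ q ∈ Q, Measure.dirac q.1) = ∑ q ∈ Q, f q.1 := by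
  have : (∑ q ∈ Q, Measure.dirac q.1 : Measure ℝ).restrict B = ∑ q ∈ Q, Measure.dirac q.1 := by
    refine Measure.restrict_eq_self_of_ae_mem ?_
    rw [ae_iff, Measure.finsetSum_apply]
    refine Finset.sum_eq_zero fun q hq => ?_
    rw [show {a | a ∉ B} = Bᶜ from rfl, Measure.dirac_apply' _ hB.compl]
    simp [hQ q hq]
  rw [this, integral_finsetSum_measure fun q _ => integrable_dirac (by simp)]
  simp

/-! ### Convergence of the data term -/

/-- On a compact parameter set the densities are bounded above and bounded away from zero,
uniformly in the parameter. -/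
theorem exists_uniform_density_bounds {d : ℕ} {A : Set (EuclideanSpace ℝ (Fin d))}
    {ρ : EuclideanSpace ℝ (Fin d) → Plane → ℝ} (hA : IsCompact A)
    (hρ : ContinuousIntoLipschitz A ρ) (hpos : ∀ p ∈ A, ∃ c > 0, ∀ y, c ≤ ρ p y) :
    ∃ c > 0, ∃ M, ∀ p ∈ A, ∀ y, c ≤ ρ p y ∧ ρ p y ≤ M := by
  refine hA.induction_on (p := fun S => ∃ c > (0 : ℝ), ∃ M : ℝ, ∀ p ∈ S, ∀ y,
    c ≤ ρ p y ∧ ρ p y ≤ M) ⟨1, one_pos, 1, by simp⟩ ?_ ?_ ?_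
  · rintro S S' hS ⟨c, hc, M, h⟩
    exact ⟨c, hc, M, fun p hp => h p (hS hp)⟩
  · rintro S S' ⟨c, hc, M, h⟩ ⟨c', hc', M', h'⟩
    refine ⟨min c c', lt_min hc hc', max M M', ?_⟩
    rintro p (hp | hp) y
    · exact ⟨(min_le_left _ _).trans (h p hp y).1, (h p hp y).2.trans (le_max_left _ _)⟩
    · exact ⟨(min_le_right _ _).trans (h' p hp y).1, (h' p hp y).2.trans (le_max_right _ _)⟩
  · intro p hp
    obtain ⟨c, hc, hcp⟩ := hpos p hp
    obtain ⟨M, hM, -⟩ := hρ.1 p hp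
    obtain ⟨δ, hδ, hq⟩ := hρ.2 p hp (c / 2) (half_pos hc)
    refine ⟨A ∩ Metric.ball p δ,
      inter_mem_nhdsWithin A (Metric.ball_mem_nhds p hδ), c / 2, half_pos hc,
      M + c / 2, ?_⟩
    rintro q ⟨hqA, hqp⟩ y
    have h1 := abs_le.1 ((hq q hqA hqp).1 y)
    have h2 := abs_le.1 (hM y)
    exact ⟨by linarith [hcp y], by linarith⟩

theorem continuous_density {d : ℕ} {A : Set (EuclideanSpace ℝ (Fin d))}
    {ρ : EuclideanSpace ℝ (Fin d) → Plane → ℝ} (hρ : ContinuousIntoLipschitz A ρ)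
    {p : EuclideanSpace ℝ (Fin d)} (hp : p ∈ A) : Continuous (ρ p) := by
  obtain ⟨M, -, hM⟩ := hρ.1 p hp
  refine (LipschitzWith.of_dist_le' (K := M) fun y z => ?_).continuous
  rw [Real.dist_eq, dist_eq_norm]
  exact hM y z

theorem tendsto_density {d : ℕ} {A : Set (EuclideanSpace ℝ (Fin d))}
    {ρ : EuclideanSpace ℝ (Fin d) → Plane → ℝ} (hρ : ContinuousIntoLipschitz A ρ)
    {p : EuclideanSpace ℝ (Fin d)} (hp : p ∈ A) {ps : ℕ → EuclideanSpace ℝ (Fin d)}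
    (hps : ∀ n, ps n ∈ A) (hlim : Tendsto ps atTop (𝓝 p)) {y : ℕ → Plane} {z : Plane}
    (hy : Tendsto y atTop (𝓝 z)) : Tendsto (fun n => ρ (ps n) (y n)) atTop (𝓝 (ρ p z)) := by
  have h1 : Tendsto (fun n => ρ p (y n)) atTop (𝓝 (ρ p z)) :=
    ((continuous_density hρ hp).tendsto z).comp hy
  have h2 : Tendsto (fun n => ρ (ps n) (y n) - ρ p (y n)) atTop (𝓝 0) := by
    rw [Metric.tendsto_nhds]
    intro ε hε
    obtain ⟨δ, hδ, hq⟩ := hρ.2 p hp (ε / 2) (half_pos hε)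
    filter_upwards [(Metric.tendsto_nhds.1 hlim) δ hδ] with n hn
    rw [Real.dist_eq, sub_zero]
    exact ((hq _ (hps n) hn).1 _).trans_lt (half_lt_self hε)
  simpa using h2.add h1

/-- The number of electron events in the `i`-th pixel, for events at the times `q.1`, `q ∈ Q`. -/
noncomputable def pixelCount (T : ℝ) (N : ℕ) (Q : Finset (ℝ × ℝ)) (i : ℕ) : ℕ :=
  open Classical in (Q.filter fun q => q.1 ∈ Ico (i * T / N : ℝ) ((i + 1) * T / N)).card

theorem sum_pixelCount_mul {T : ℝ} (hT : 0 < T) {N : ℕ} (hN : 0 < N) {Q : Finset (ℝ × ℝ)}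
    (hQ : ∀ q ∈ Q, q.1 ∈ Ico 0 T) (h : ℕ → ℝ) :
    ∑ i ∈ Finset.range N, pixelCount T N Q i * h i = ∑ q ∈ Q, h ⌊q.1 * N / T⌋₊ := by
  classical
  have hmaps : ∀ q ∈ Q, ⌊q.1 * N / T⌋₊ ∈ Finset.range N := fun q hq =>
    Finset.mem_range.2 (floor_grid_lt hT hN (hQ q hq))
  rw [← Finset.sum_fiberwise_of_maps_to hmaps]
  refine Finset.sum_congr rfl fun i _ => ?_
  have : (Q.filter fun q => q.1 ∈ Ico (i * T / N : ℝ) ((i + 1) * T / N))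
      = Q.filter fun q => ⌊q.1 * N / T⌋₊ = i := by
    refine Finset.filter_congr fun q hq => ?_
    rw [← floor_grid_eq hT hN]
    exact and_iff_right (hQ q hq).1
  rw [pixelCount, this, ← nsmul_eq_mul, ← Finset.sum_const]
  refine Finset.sum_congr rfl fun q hq => ?_
  rw [(Finset.mem_filter.1 hq).2]

/-- Extension of a family indexed by pixels by zero. -/
def zeroExtend {N : ℕ} (u : Fin N → ℝ) (i : ℕ) : ℝ := if h : i < N then u ⟨i, h⟩ else 0

theorem zeroExtend_val {N : ℕ} (u : Fin N → ℝ) (i : Fin N) : zeroExtend u i = u i := by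
  rw [zeroExtend, dif_pos i.2]

/-- The discrete data term as an integral of a step function minus a sum over the electron
events. -/
theorem sum_data_eq {T : ℝ} (hT : 0 < T) {N : ℕ} (hN : 0 < N) {Q : Finset (ℝ × ℝ)}
    (hQ : ∀ q ∈ Q, q.1 ∈ Ico 0 T) (u : Fin N → ℝ) :
    ∑ i : Fin N, (T / N * u i - pixelCount T N Q i * Real.log (u i))
      = (∫ t in (0 : ℝ)..T, zeroExtend u ⌊t * N / T⌋₊)
        - ∑ q ∈ Q, Real.log (zeroExtend u ⌊q.1 * N / T⌋₊) := by
  rw [integral_step_total hT hN, ← sum_pixelCount_mul hT hN hQ fun i => Real.log (zeroExtend u i),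
    ← Finset.sum_sub_distrib, ← Fin.sum_univ_eq_sum_range
      (fun i => (T / N : ℝ) • zeroExtend u i - pixelCount T N Q i * Real.log (zeroExtend u i))]
  refine Finset.sum_congr rfl fun i _ => ?_
  rw [zeroExtend_val, smul_eq_mul]

theorem zeroExtend_floor_bounds {T : ℝ} (hT : 0 < T) {N : ℕ} (hN : 0 < N) {u : Fin N → ℝ}
    {c M : ℝ} (hu : ∀ i, c ≤ u i ∧ u i ≤ M) {t : ℝ} (ht : t ∈ Ico 0 T) :
    c ≤ zeroExtend u ⌊t * N / T⌋₊ ∧ zeroExtend u ⌊t * N / T⌋₊ ≤ M := by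
  rw [zeroExtend, dif_pos (floor_grid_lt hT hN ht)]
  exact hu _

/-- The discrete data term is bounded below. -/
theorem neg_le_sum_data {T : ℝ} (hT : 0 < T) {N : ℕ} (hN : 0 < N) {Q : Finset (ℝ × ℝ)}
    (hQ : ∀ q ∈ Q, q.1 ∈ Ico 0 T) {u : Fin N → ℝ} {c M : ℝ} (hc : 0 < c)
    (hu : ∀ i, c ≤ u i ∧ u i ≤ M) :
    -(Q.card * Real.log M) ≤ ∑ i : Fin N, (T / N * u i - pixelCount T N Q i * Real.log (u i)) := by
  rw [sum_data_eq hT hN hQ]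
  have h1 : 0 ≤ ∫ t in (0 : ℝ)..T, zeroExtend u ⌊t * N / T⌋₊ := by
    refine intervalIntegral.integral_nonneg hT.le fun t _ => ?_
    rw [zeroExtend]
    split_ifs with h
    · exact hc.le.trans (hu _).1
    · exact le_rfl
  have h2 : ∑ q ∈ Q, Real.log (zeroExtend u ⌊q.1 * N / T⌋₊) ≤ ∑ q ∈ Q, Real.log M := by
    refine Finset.sum_le_sum fun q hq => ?_
    have := zeroExtend_floor_bounds hT hN hu (hQ q hq)
    exact Real.log_le_log (hc.trans_le this.1) this.2
  rw [Finset.sum_const, nsmul_eq_mul] at h2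
  linarith

/-- The weak `H¹` limit may be taken in the data term: the sampled paths converge pointwise, by
pointwise convergence of the representatives and their common Hölder bound. -/
theorem tendsto_sum_data {T : ℝ} (hT : 0 < T) {N : ℕ → ℕ} (hN : ∀ n, 0 < N n)
    (hNlim : Tendsto N atTop atTop) {x : (n : ℕ) → Fin (N n) → Plane} {xlim : ℝ → Plane}
    (hx : ∀ t ∈ Ico 0 T, Tendsto (fun n => scanPath T (x n) t) atTop (𝓝 (xlim t)))
    {d : ℕ} {A : Set (EuclideanSpace ℝ (Fin d))} {ρ : EuclideanSpace ℝ (Fin d) → Plane → ℝ}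
    (hρ : ContinuousIntoLipschitz A ρ) {c M : ℝ} (hc : 0 < c)
    (hbd : ∀ p ∈ A, ∀ y, c ≤ ρ p y ∧ ρ p y ≤ M) {Q : Finset (ℝ × ℝ)}
    (hQ : ∀ q ∈ Q, q.1 ∈ Ico 0 T) {U : ℕ → H1 T} {W : H1 T}
    (hU : ∀ f : StrongDual ℝ (H1 T), Tendsto (fun n => f (U n)) atTop (𝓝 (f W)))
    {ps : ℕ → EuclideanSpace ℝ (Fin d)} {p : EuclideanSpace ℝ (Fin d)} (hps : ∀ n, ps n ∈ A)
    (hp : p ∈ A) (hlim : Tendsto ps atTop (𝓝 p)) :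
    Tendsto (fun n => ∑ i : Fin (N n),
        (T / N n * ρ (ps n) (x n i + H1.rep (U n) (((i : ℕ) + 1) * T / N n))
          - pixelCount T (N n) Q i
            * Real.log (ρ (ps n) (x n i + H1.rep (U n) (((i : ℕ) + 1) * T / N n)))))
      atTop (𝓝 (klDivergence T (∑ q ∈ Q, Measure.dirac q.1)
        (fun t => ρ p (xlim t + H1.rep W t)))) := by
  have hNr : Tendsto (fun n => ((N n : ℕ) : ℝ)) atTop atTop :=
    tendsto_natCast_atTop_atTop.comp hNlim
  obtain ⟨B, hB⟩ := exists_norm_le_of_tendsto_weakly hU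
  set u : (n : ℕ) → Fin (N n) → ℝ := fun n i =>
    ρ (ps n) (x n i + H1.rep (U n) (((i : ℕ) + 1) * T / N n)) with hu
  have hub : ∀ n i, c ≤ u n i ∧ u n i ≤ M := fun n i => hbd _ (hps n) _
  -- pointwise convergence of the sampled paths
  have hpath : ∀ t ∈ Ico 0 T, Tendsto
      (fun n => H1.rep (U n) ((⌊t * N n / T⌋₊ + 1) * T / N n)) atTop (𝓝 (H1.rep W t)) := by
    intro t ht
    have ht' := Ico_subset_Icc_self ht
    have h1 := H1.tendsto_rep hT hU ht'
    have h2 : Tendsto (fun n => H1.rep (U n) ((⌊t * N n / T⌋₊ + 1) * T / N n) - H1.rep (U n) t)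
        atTop (𝓝 0) := by
      have hz : Tendsto (fun n => √(T / N n * B ^ 2)) atTop (𝓝 0) := by
        have h1 : Tendsto (fun n => T / (N n : ℝ) * B ^ 2) atTop (𝓝 (0 * B ^ 2)) :=
          (tendsto_const_nhds.div_atTop hNr).mul_const _
        have := (Real.continuous_sqrt.tendsto _).comp h1
        simpa [Function.comp_def] using this
      refine squeeze_zero_norm (fun n => ?_) hz
      have hN' : (0 : ℝ) < N n := by exact_mod_cast hN n
      have hlt := floor_grid_lt hT (hN n) ht
      have hm : (⌊t * N n / T⌋₊ + 1) * T / N n ∈ Icc 0 T :=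
        grid_mem_Icc hT (hN n) (by positivity) (by exact_mod_cast hlt)
      refine (H1.norm_rep_sub_le hT (U n) ht' hm).trans (Real.sqrt_le_sqrt ?_)
      have hg := (floor_grid_eq hT (hN n)).1 ⟨ht.1, rfl⟩
      have habs : |(⌊t * N n / T⌋₊ + 1) * T / N n - t| ≤ T / N n := by
        rw [abs_of_nonneg (sub_nonneg.2 hg.2.le)]
        have e : (⌊t * N n / T⌋₊ + 1) * T / N n = ⌊t * N n / T⌋₊ * T / N n + T / N n := by ring
        rw [e]
        linarith [hg.1]
      have hsem : H1.seminormSq (U n) ≤ B ^ 2 :=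
        (H1.seminormSq_le_norm_sq _).trans (pow_le_pow_left₀ (norm_nonneg _) (hB n) 2)
      exact mul_le_mul habs hsem (H1.seminormSq_nonneg _) (by positivity)
    simpa using h2.add h1
  have hpt : ∀ t ∈ Ico 0 T, Tendsto (fun n => zeroExtend (u n) ⌊t * N n / T⌋₊) atTop
      (𝓝 (ρ p (xlim t + H1.rep W t))) := by
    intro t ht
    refine (tendsto_density hρ hp hps hlim ((hx t ht).add (hpath t ht))).congr fun n => ?_
    have hlt := floor_grid_lt hT (hN n) ht
    rw [zeroExtend, dif_pos hlt, scanPath, dif_pos hlt]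
  have hint : Tendsto (fun n => ∫ t in (0 : ℝ)..T, zeroExtend (u n) ⌊t * N n / T⌋₊) atTop
      (𝓝 (∫ t in (0 : ℝ)..T, ρ p (xlim t + H1.rep W t))) := by
    simp only [intervalIntegral.integral_of_le hT.le, integral_Ioc_eq_integral_Ioo]
    refine tendsto_integral_of_dominated_convergence (fun _ => M)
      (fun n => (stronglyMeasurable_step T (N n) _).aestronglyMeasurable) (integrable_const _)
      (fun n => ?_) ?_
    · filter_upwards [ae_restrict_mem measurableSet_Ioo] with t ht
      have := zeroExtend_floor_bounds hT (hN n) (hub n) (Ioo_subset_Ico_self ht)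
      rw [Real.norm_of_nonneg (hc.le.trans this.1)]
      exact this.2
    · filter_upwards [ae_restrict_mem measurableSet_Ioo] with t ht
      exact hpt t (Ioo_subset_Ico_self ht)
  have hsum : Tendsto (fun n => ∑ q ∈ Q, Real.log (zeroExtend (u n) ⌊q.1 * N n / T⌋₊)) atTop
      (𝓝 (∑ q ∈ Q, Real.log (ρ p (xlim q.1 + H1.rep W q.1)))) := by
    refine tendsto_finsetSum _ fun q hq => ?_
    exact (hpt q.1 (hQ q hq)).log (hc.trans_le (hbd p hp _).1).ne'
  have hkl : klDivergence T (∑ q ∈ Q, Measure.dirac q.1) (fun t => ρ p (xlim t + H1.rep W t))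
      = (∫ t in (0 : ℝ)..T, ρ p (xlim t + H1.rep W t))
        - ∑ q ∈ Q, Real.log (ρ p (xlim q.1 + H1.rep W q.1)) := by
    rw [klDivergence, setIntegral_sum_dirac Q measurableSet_Icc
      (fun q hq => Ico_subset_Icc_self (hQ q hq))
      (fun t => Real.log (ρ p (xlim t + H1.rep W t))),
      intervalIntegral.integral_of_le hT.le, integral_Icc_eq_integral_Ioc]
  rw [hkl]
  exact (hint.sub hsum).congr fun n => (sum_data_eq hT (hN n) hQ (u n)).symm

/-- The almost sure behaviour of the signals `g n`: up to noise small compared to the gain `α`, and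
for large `n`, the signal of a pixel counts the elements of a fixed finite set of electron events
that fall into this pixel; moreover the noise level is small compared to the dwell time. -/
structure IsRegularSignal (T α μ : ℝ) (N : ℕ → ℕ) (σ : ℕ → ℝ) (g : (n : ℕ) → Fin (N n) → ℝ)
    (Q : Finset (ℝ × ℝ)) : Prop where
  time_mem : ∀ q ∈ Q, q.1 ∈ Ico 0 T
  signal_eq : ∀ᶠ n in atTop, ∃ r : Fin (N n) → ℝ, (∀ i, |σ n * r i| ≤ α / 4) ∧
    ∀ i, g n i = α * pixelCount T (N n) Q i + (μ + σ n * r i)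
  sigma_pos : ∀ n, 0 < σ n
  sigma_le : ∀ᶠ n in atTop, σ n * N n ≤ α

/-- After subtraction of the constants, the discrete data term differs from its Poisson
counterpart by an error that vanishes uniformly over all reconstructions with densities in
`[c, M]`. -/
theorem IsRegularSignal.exists_error_tendsto_zero {T α μ : ℝ} (hT : 0 < T) (hα : 0 < α)
    {N : ℕ → ℕ} (hN : ∀ n, 0 < N n) (hNlim : Tendsto N atTop atTop) {σ : ℕ → ℝ}
    {g : (n : ℕ) → Fin (N n) → ℝ} {Q : Finset (ℝ × ℝ)} (hg : IsRegularSignal T α μ N σ g Q)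
    {c M : ℝ} (hc : 0 < c) :
    ∃ ε : ℕ → ℝ, Tendsto ε atTop (𝓝 0) ∧ ∀ᶠ n in atTop, ∀ u : Fin (N n) → ℝ,
      (∀ i, c ≤ u i ∧ u i ≤ M) →
      |∑ i, dissimilarity α μ (σ n) (g n i) (T / N n * u i)
        - normalizationConstant T α (N n) (normalizedSignal T α μ (g n)) (σ n)
        - ∑ i : Fin (N n), (T / N n * u i - pixelCount T (N n) Q i * Real.log (u i))| ≤ ε n := by
  set F : ℕ → ℝ := fun m => (m : ℝ) * (4 * ((T * M / m + Q.card / (T * c) * m)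
    * Real.exp (-((m : ℝ) ^ 2 / 4)))) with hF
  have hFlim : Tendsto F atTop (𝓝 0) := tendsto_mul_error_zero (T * M) (Q.card / (T * c))
  refine ⟨fun n => F (N n), hFlim.comp hNlim, ?_⟩
  have hsmall : ∀ᶠ n in atTop, F (N n) < 1 :=
    (hFlim.comp hNlim).eventually_lt_const one_pos
  filter_upwards [hg.signal_eq, hg.sigma_le, hsmall] with n ⟨r, hr, hgr⟩ hσ hlt u hu
  have hσ0 := hg.sigma_pos n
  have hN' : (0 : ℝ) < N n := by exact_mod_cast hN n
  have hN1 : (1 : ℝ) ≤ N n := by exact_mod_cast hN n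
  set q := (T * M / N n + Q.card / (T * c) * N n) * Real.exp (-((N n : ℝ) ^ 2 / 4)) with hq
  have hM : 0 ≤ M := (hc.le.trans (hu ⟨0, hN n⟩).1).trans (hu ⟨0, hN n⟩).2
  have hq0 : 0 ≤ q := by positivity
  have hq1 : q ≤ 1 / 2 := by
    have h1 : (N n : ℝ) * (4 * q) < 1 := hlt
    nlinarith
  refine abs_sum_dissimilarity_sub_le hT hα (hN n) hσ0 (fun i => hc.trans_le (hu i).1) hr hgr hq1
    fun i => ?_
  have hui := hc.trans_le (hu i).1
  have hT' : 0 < T / N n := by positivity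
  refine mul_le_mul (add_le_add ?_ ?_) (Real.exp_le_exp.2 (neg_le_neg ?_)) (Real.exp_pos _).le
    (by positivity)
  · rw [div_mul_eq_mul_div]
    have := (hu i).2
    gcongr
  · have hk : (pixelCount T (N n) Q i : ℝ) ≤ Q.card := by
      exact_mod_cast Finset.card_filter_le _ _
    have h1 : T / N n * c ≤ T / N n * u i := mul_le_mul_of_nonneg_left (hu i).1 hT'.le
    calc (pixelCount T (N n) Q i : ℝ) / (T / N n * u i) ≤ Q.card / (T / N n * c) := by gcongr
      _ = Q.card / (T * c) * N n := by field_simp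
  · rw [le_div_iff₀ (by positivity)]
    have h1 : (σ n * N n) ^ 2 ≤ α ^ 2 := pow_le_pow_left₀ (by positivity) hσ 2
    nlinarith

/-! ### Gamma-convergence and convergence of minimizers -/

/-- Limits of subsequences of minimizers are minimizers of the Gamma-limit. -/
theorem GammaConverges.isMinimizer_of_tendsto {X : Type*} [TopologicalSpace X] {E : ℕ → X → EReal}
    {F : X → EReal} {C : ℕ → ℝ} (h : GammaConverges (fun n v => E n v - (C n : EReal)) F)
    {u : ℕ → X} (hu : ∀ n, IsMinimizer (E n) (u n)) {θ : ℕ → ℕ} (hθ : StrictMono θ) {v : X}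
    (hv : Tendsto (fun k => u (θ k)) atTop (𝓝 v)) : IsMinimizer F v := by
  classical
  intro y
  obtain ⟨yr, -, hyr⟩ := h.2 y
  have hmap : map θ atTop ≤ atTop := hθ.tendsto_atTop
  -- off the range of the subsequence, the limit itself is inserted
  set u' : ℕ → X := fun n => if n ∈ range θ then u n else v with hu'
  have htend : Tendsto u' atTop (𝓝 v) := by
    refine tendsto_def.2 fun s hs => ?_
    obtain ⟨K, hK⟩ := eventually_atTop.1 (hv.eventually hs)
    filter_upwards [eventually_ge_atTop (θ K)] with n hn
    simp only [mem_preimage, hu']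
    split_ifs with hr
    · obtain ⟨k, rfl⟩ := hr
      exact hK k (hθ.le_iff_le.1 hn)
    · exact mem_of_mem_nhds hs
  calc F v ≤ liminf (fun n => E n (u' n) - (C n : EReal)) atTop := h.1 v u' htend
    _ ≤ liminf (fun n => E n (u' n) - (C n : EReal)) (map θ atTop) := liminf_le_liminf_of_le hmap
    _ ≤ limsup (fun n => E n (u' n) - (C n : EReal)) (map θ atTop) := liminf_le_limsup
    _ ≤ limsup (fun n => E n (yr n) - (C n : EReal)) (map θ atTop) := by
        refine limsup_le_limsup ?_
        refine eventually_map.2 (Eventually.of_forall fun k => ?_)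
        simp only [hu', if_pos (mem_range_self k)]
        exact EReal.sub_le_sub (hu _ _) le_rfl
    _ ≤ limsup (fun n => E n (yr n) - (C n : EReal)) atTop := limsup_le_limsup_of_le hmap
    _ ≤ F y := hyr

/-- The data term of the discrete energy minus the normalization constant. -/
noncomputable def reducedData (T α μ σ : ℝ) (h : Plane → ℝ) {N : ℕ} (x : Fin N → Plane)
    (g : Fin N → ℝ) (W : H1 T) : ℝ :=
  ∑ i : Fin N, dissimilarity α μ σ (g i) (T / N * h (x i + H1.rep W (((i : ℕ) + 1) * T / N)))
    - normalizationConstant T α N (normalizedSignal T α μ g) σ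

theorem pathEnergy_sub_eq {T : ℝ} (hT : 0 < T) {d : ℕ} {D α μ σ : ℝ}
    {A : Set (EuclideanSpace ℝ (Fin d))} {ρ : EuclideanSpace ℝ (Fin d) → Plane → ℝ} {w₀ : Plane}
    {N : ℕ} (hN : 0 < N) {x : Fin N → Plane} {g : Fin N → ℝ} {W : H1 T}
    {p : EuclideanSpace ℝ (Fin d)} (hW : IsPiecewiseAffine T N (H1.rep W))
    (hW0 : H1.rep W 0 = w₀) (hp : p ∈ A) :
    pathEnergy T D α μ σ A ρ w₀ x g W p
        - (normalizationConstant T α N (normalizedSignal T α μ g) σ : EReal)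
      = ((reducedData T α μ σ (ρ p) x g W + 1 / (2 * D) * H1.seminormSq W : ℝ) : EReal) := by
  have hkin : H1.seminormSq W = ∑ i : Fin N, ‖H1.rep W (((i : ℕ) + 1) * T / N)
      - H1.rep W ((i : ℕ) * T / N)‖ ^ 2 / (T / N) := by
    conv_lhs => rw [H1.eq_interp_of_isPiecewiseAffine hT hN hW]
    rw [H1.seminormSq_interp hT hN, ← Fin.sum_univ_eq_sum_range
      fun i => ‖H1.rep W ((i + 1) * T / N) - H1.rep W (i * T / N)‖ ^ 2 / (T / N)]
  rw [pathEnergy, if_pos ⟨hW, hW0⟩, discreteEnergy, indicatorFn, if_pos hp, add_zero,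
    ← EReal.coe_sub, hkin, reducedData]
  simp only [Fin.val_succ, Fin.val_castSucc, Nat.cast_succ]
  congr 1
  ring

theorem pathEnergy_sub_eq_top {T : ℝ} {d : ℕ} {D α μ σ : ℝ}
    {A : Set (EuclideanSpace ℝ (Fin d))} {ρ : EuclideanSpace ℝ (Fin d) → Plane → ℝ} {w₀ : Plane}
    {N : ℕ} {x : Fin N → Plane} {g : Fin N → ℝ} {W : H1 T} {p : EuclideanSpace ℝ (Fin d)}
    (h : ¬(IsPiecewiseAffine T N (H1.rep W) ∧ H1.rep W 0 = w₀ ∧ p ∈ A)) (C : ℝ) :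
    pathEnergy T D α μ σ A ρ w₀ x g W p - (C : EReal) = ⊤ := by
  rw [pathEnergy]
  split_ifs with h1
  · have hp : p ∉ A := fun hp => h ⟨h1.1, h1.2, hp⟩
    rw [discreteEnergy, indicatorFn, if_neg hp, EReal.coe_add_top, EReal.top_sub_coe]
  · rw [EReal.top_sub_coe]

theorem limitEnergy_eq {T : ℝ} {d : ℕ} {D : ℝ}
    {A : Set (EuclideanSpace ℝ (Fin d))} {ρ : EuclideanSpace ℝ (Fin d) → Plane → ℝ} {w₀ : Plane}
    {x : ℝ → Plane} {m : Measure ℝ} {W : H1 T} {p : EuclideanSpace ℝ (Fin d)}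
    (hW0 : H1.rep W 0 = w₀) (hp : p ∈ A) :
    limitEnergy T D A ρ w₀ x m W p
      = ((klDivergence T m (fun t => ρ p (x t + H1.rep W t))
        + 1 / (2 * D) * H1.seminormSq W : ℝ) : EReal) := by
  rw [limitEnergy, if_pos hW0, indicatorFn, if_pos hp, add_zero]

theorem limitEnergy_eq_top {T : ℝ} {d : ℕ} {D : ℝ}
    {A : Set (EuclideanSpace ℝ (Fin d))} {ρ : EuclideanSpace ℝ (Fin d) → Plane → ℝ} {w₀ : Plane}
    {x : ℝ → Plane} {m : Measure ℝ} {W : H1 T} {p : EuclideanSpace ℝ (Fin d)}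
    (h : ¬(H1.rep W 0 = w₀ ∧ p ∈ A)) : limitEnergy T D A ρ w₀ x m W p = ⊤ := by
  rw [limitEnergy]
  split_ifs with h1
  · have hp : p ∉ A := fun hp => h ⟨h1, hp⟩
    rw [indicatorFn, if_neg hp, EReal.coe_add_top]
  · rfl

theorem exists_modification_mem {X : Type*} [PseudoMetricSpace X] {A : Set X} {ps : ℕ → X} {p : X}
    (hps : Tendsto ps atTop (𝓝 p)) (hp : p ∈ A) :
    ∃ ps' : ℕ → X, (∀ n, ps' n ∈ A) ∧ Tendsto ps' atTop (𝓝 p) ∧ ∀ n, ps n ∈ A → ps' n = ps n := by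
  classical
  refine ⟨fun n => if ps n ∈ A then ps n else p, fun n => ?_, ?_, fun n hn => if_pos hn⟩
  · dsimp only
    split_ifs with h
    · exact h
    · exact hp
  · refine tendsto_iff_dist_tendsto_zero.2 (squeeze_zero (fun n => dist_nonneg) (fun n => ?_)
      (tendsto_iff_dist_tendsto_zero.1 hps))
    split_ifs with h
    · exact le_rfl
    · rw [dist_self]; exact dist_nonneg

/-- The deterministic assumptions on one realization of the data: compactly parametrized, uniformly
bounded positive densities, converging scan paths, and a regular signal. -/
structure IsReconstructionSetting (T D α μ : ℝ) {d : ℕ} (A : Set (EuclideanSpace ℝ (Fin d)))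
    (ρ : EuclideanSpace ℝ (Fin d) → Plane → ℝ) (c M : ℝ) (N : ℕ → ℕ)
    (x : (n : ℕ) → Fin (N n) → Plane) (xlim : ℝ → Plane) (σ : ℕ → ℝ)
    (g : (n : ℕ) → Fin (N n) → ℝ) (Q : Finset (ℝ × ℝ)) : Prop where
  T_pos : 0 < T
  D_pos : 0 < D
  α_pos : 0 < α
  isCompact : IsCompact A
  nonempty : A.Nonempty
  continuous : ContinuousIntoLipschitz A ρ
  c_pos : 0 < c
  bounds : ∀ p ∈ A, ∀ y, c ≤ ρ p y ∧ ρ p y ≤ M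
  N_pos : ∀ n, 0 < N n
  N_lim : Tendsto N atTop atTop
  path_lim : ∀ t ∈ Ico 0 T, Tendsto (fun n => scanPath T (x n) t) atTop (𝓝 (xlim t))
  signal : IsRegularSignal T α μ N σ g Q

namespace IsReconstructionSetting

variable {T D α μ : ℝ} {d : ℕ} {A : Set (EuclideanSpace ℝ (Fin d))}
    {ρ : EuclideanSpace ℝ (Fin d) → Plane → ℝ} {c M : ℝ} {N : ℕ → ℕ}
    {x : (n : ℕ) → Fin (N n) → Plane} {xlim : ℝ → Plane} {σ : ℕ → ℝ}
    {g : (n : ℕ) → Fin (N n) → ℝ} {Q : Finset (ℝ × ℝ)}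

theorem tendsto_reducedData (hS : IsReconstructionSetting T D α μ A ρ c M N x xlim σ g Q)
    {U : ℕ → H1 T} {W : H1 T}
    (hU : ∀ f : StrongDual ℝ (H1 T), Tendsto (fun n => f (U n)) atTop (𝓝 (f W)))
    {ps : ℕ → EuclideanSpace ℝ (Fin d)} {p : EuclideanSpace ℝ (Fin d)} (hps : ∀ n, ps n ∈ A)
    (hp : p ∈ A) (hlim : Tendsto ps atTop (𝓝 p)) :
    Tendsto (fun n => reducedData T α μ (σ n) (ρ (ps n)) (x n) (g n) (U n)) atTop
      (𝓝 (klDivergence T (∑ q ∈ Q, Measure.dirac q.1) (fun t => ρ p (xlim t + H1.rep W t)))) := by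
  obtain ⟨ε, hε, hbound⟩ := hS.signal.exists_error_tendsto_zero hS.T_pos hS.α_pos hS.N_pos hS.N_lim
    (M := M) hS.c_pos
  have h1 := tendsto_sum_data hS.T_pos hS.N_pos hS.N_lim hS.path_lim hS.continuous hS.c_pos
    hS.bounds hS.signal.time_mem hU hps hp hlim
  have h2 := squeeze_zero_norm'
    (f := fun n => reducedData T α μ (σ n) (ρ (ps n)) (x n) (g n) (U n)
      - ∑ i : Fin (N n), (T / N n * ρ (ps n) (x n i + H1.rep (U n) (((i : ℕ) + 1) * T / N n))
        - pixelCount T (N n) Q i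
          * Real.log (ρ (ps n) (x n i + H1.rep (U n) (((i : ℕ) + 1) * T / N n)))))
    (hbound.mono fun n hn => hn (fun i => ρ (ps n) (x n i + H1.rep (U n) (((i : ℕ) + 1) * T / N n)))
      fun i => hS.bounds _ (hps n) _) hε
  have h3 := h2.add h1
  rw [zero_add] at h3
  exact h3.congr fun n => sub_add_cancel _ _

theorem eventually_le_reducedData
    (hS : IsReconstructionSetting T D α μ A ρ c M N x xlim σ g Q) :
    ∃ B : ℝ, ∀ᶠ n in atTop, ∀ (W : H1 T), ∀ p ∈ A,
      B ≤ reducedData T α μ (σ n) (ρ p) (x n) (g n) W := by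
  obtain ⟨ε, hε, hbound⟩ := hS.signal.exists_error_tendsto_zero hS.T_pos hS.α_pos hS.N_pos hS.N_lim
    (M := M) hS.c_pos
  refine ⟨-(Q.card * Real.log M) - 1, ?_⟩
  filter_upwards [hbound, hε.eventually_lt_const one_pos] with n h1 h2 W p hp
  have hu : ∀ i : Fin (N n), c ≤ ρ p (x n i + H1.rep W (((i : ℕ) + 1) * T / N n)) ∧
      ρ p (x n i + H1.rep W (((i : ℕ) + 1) * T / N n)) ≤ M := fun i => hS.bounds p hp _
  have h3 := (abs_le.1 (h1 _ hu)).1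
  have h4 := neg_le_sum_data hS.T_pos (hS.N_pos n) hS.signal.time_mem hS.c_pos hu
  rw [reducedData]
  linarith

/-- The liminf inequality. -/
theorem le_liminf (hS : IsReconstructionSetting T D α μ A ρ c M N x xlim σ g Q) (w₀ : Plane)
    {U : ℕ → H1 T} {W : H1 T}
    (hU : ∀ f : StrongDual ℝ (H1 T), Tendsto (fun n => f (U n)) atTop (𝓝 (f W)))
    {ps : ℕ → EuclideanSpace ℝ (Fin d)} {p : EuclideanSpace ℝ (Fin d)}
    (hps : Tendsto ps atTop (𝓝 p)) :
    limitEnergy T D A ρ w₀ xlim (∑ q ∈ Q, Measure.dirac q.1) W p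
      ≤ liminf (fun n => pathEnergy T D α μ (σ n) A ρ w₀ (x n) (g n) (U n) (ps n)
        - (normalizationConstant T α (N n) (normalizedSignal T α μ (g n)) (σ n) : EReal))
          atTop := by
  by_cases hadm : H1.rep W 0 = w₀ ∧ p ∈ A
  · rw [limitEnergy_eq hadm.1 hadm.2]
    -- parameters outside of `A`, where the energy is infinite, are replaced by the limit
    obtain ⟨ps', hpsA, hpslim, hpseq⟩ := exists_modification_mem hps hadm.2
    have hdata := hS.tendsto_reducedData hU hpsA hadm.2 hpslim
    generalize klDivergence T (∑ q ∈ Q, Measure.dirac q.1)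
      (fun t => ρ p (xlim t + H1.rep W t)) = kl at hdata ⊢
    have hD := hS.D_pos
    refine le_of_forall_lt_imp_le_of_dense fun b hb => ?_
    obtain ⟨b', hbb', hb'⟩ := EReal.lt_iff_exists_real_btwn.1 hb
    rw [EReal.coe_lt_coe_iff] at hb'
    obtain ⟨δ, hδ⟩ : ∃ δ, δ = (kl + 1 / (2 * D) * H1.seminormSq W - b') / 2 := ⟨_, rfl⟩
    have hδ0 : 0 < δ := by rw [hδ]; linarith
    refine le_liminf_of_le (by isBoundedDefault) ?_
    filter_upwards [hdata.eventually_const_lt (show kl - δ < kl by linarith),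
      H1.eventually_lt_seminormSq hU
        (show H1.seminormSq W - 2 * D * δ < H1.seminormSq W by nlinarith)] with n h1 h2
    refine hbb'.le.trans ?_
    by_cases hn : IsPiecewiseAffine T (N n) (H1.rep (U n)) ∧ H1.rep (U n) 0 = w₀ ∧ ps n ∈ A
    · rw [pathEnergy_sub_eq hS.T_pos (hS.N_pos n) hn.1 hn.2.1 hn.2.2, EReal.coe_le_coe_iff]
      rw [hpseq n hn.2.2] at h1
      have h3 : 1 / (2 * D) * (H1.seminormSq W - 2 * D * δ) ≤ 1 / (2 * D) * H1.seminormSq (U n) :=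
        mul_le_mul_of_nonneg_left h2.le (by positivity)
      have h4 : 1 / (2 * D) * (H1.seminormSq W - 2 * D * δ)
          = 1 / (2 * D) * H1.seminormSq W - δ := by field_simp
      have h5 : b' = kl + 1 / (2 * D) * H1.seminormSq W - 2 * δ := by rw [hδ]; ring
      linarith
    · rw [pathEnergy_sub_eq_top hn]
      exact le_top
  · rw [limitEnergy_eq_top hadm]
    refine le_liminf_of_le (by isBoundedDefault) ?_
    have hev : ∀ᶠ n in atTop, ¬(H1.rep (U n) 0 = w₀ ∧ ps n ∈ A) := by
      by_cases h0 : H1.rep W 0 = w₀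
      · have hA : p ∉ A := fun h => hadm ⟨h0, h⟩
        filter_upwards [hps.eventually (hS.isCompact.isClosed.isOpen_compl.mem_nhds hA)] with n hn h
        exact hn h.2
      · have := H1.tendsto_rep hS.T_pos hU ⟨le_rfl, hS.T_pos.le⟩
        filter_upwards [this.eventually_ne h0] with n hn h
        exact hn h.1
    filter_upwards [hev] with n hn
    rw [pathEnergy_sub_eq_top fun h => hn h.2]

/-- The energies of the piecewise affine interpolations of an admissible path. -/
theorem exists_recovery (hS : IsReconstructionSetting T D α μ A ρ c M N x xlim σ g Q) (w₀ : Plane)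
    {W : H1 T} {p : EuclideanSpace ℝ (Fin d)} (hW : H1.rep W 0 = w₀) (hp : p ∈ A) :
    ∃ (U : ℕ → H1 T) (a : ℕ → ℝ),
      (∀ f : StrongDual ℝ (H1 T), Tendsto (fun n => f (U n)) atTop (𝓝 (f W))) ∧
      (∀ n, pathEnergy T D α μ (σ n) A ρ w₀ (x n) (g n) (U n) p
        - (normalizationConstant T α (N n) (normalizedSignal T α μ (g n)) (σ n) : EReal)
          ≤ (a n : EReal)) ∧
      Tendsto a atTop (𝓝 (klDivergence T (∑ q ∈ Q, Measure.dirac q.1)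
        (fun t => ρ p (xlim t + H1.rep W t)) + 1 / (2 * D) * H1.seminormSq W)) := by
  have hT := hS.T_pos
  have hD := hS.D_pos
  have hU := H1.tendsto_interp hT hS.N_pos hS.N_lim W
  refine ⟨fun n => H1.interp hT (N n) (H1.rep W),
    fun n => reducedData T α μ (σ n) (ρ p) (x n) (g n) (H1.interp hT (N n) (H1.rep W))
      + 1 / (2 * D) * H1.seminormSq W, hU, fun n => ?_, ?_⟩
  · rw [pathEnergy_sub_eq hT (hS.N_pos n) (H1.isPiecewiseAffine_interp hT (hS.N_pos n) _)
      ((H1.rep_interp_zero hT (hS.N_pos n) _).trans hW) hp, EReal.coe_le_coe_iff]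
    exact add_le_add_right (mul_le_mul_of_nonneg_left
      (H1.seminormSq_interp_le hT (hS.N_pos n) W) (by positivity)) _
  · exact (hS.tendsto_reducedData hU (fun _ => hp) hp tendsto_const_nhds).add_const _

theorem gammaConverges (hS : IsReconstructionSetting T D α μ A ρ c M N x xlim σ g Q)
    (w₀ : Plane) :
    GammaConverges
      (fun n v => onWeak (pathEnergy T D α μ (σ n) A ρ w₀ (x n) (g n)) v
        - (normalizationConstant T α (N n) (normalizedSignal T α μ (g n)) (σ n) : EReal))
      (onWeak (limitEnergy T D A ρ w₀ xlim (∑ q ∈ Q, Measure.dirac q.1))) := by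
  refine ⟨fun v u hu => hS.le_liminf w₀ (tendsto_weakSpace_iff.1 hu.fst_nhds) hu.snd_nhds,
    fun v => ?_⟩
  by_cases hadm : H1.rep ((toWeakSpace ℝ (H1 T)).symm v.1) 0 = w₀ ∧ v.2 ∈ A
  · obtain ⟨U, a, hU, hle, ha⟩ := hS.exists_recovery w₀ hadm.1 hadm.2
    refine ⟨fun n => (toWeakSpace ℝ (H1 T) (U n), v.2), ?_, ?_⟩
    · exact (tendsto_weakSpace_iff.2 hU).prodMk_nhds tendsto_const_nhds
    · rw [onWeak, limitEnergy_eq hadm.1 hadm.2]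
      have ha' := (continuous_coe_real_ereal.tendsto _).comp ha
      rw [← ha'.limsup_eq]
      exact limsup_le_limsup (Eventually.of_forall fun n => hle n)
  · refine ⟨fun _ => v, tendsto_const_nhds, ?_⟩
    rw [onWeak, limitEnergy_eq_top hadm]
    exact le_top

/-- Equicoercivity: minimizers are eventually bounded, with parameters in `A`. -/
theorem eventually_minimizer_bounded
    (hS : IsReconstructionSetting T D α μ A ρ c M N x xlim σ g Q) {w₀ : Plane}
    {u : ℕ → WeakH1Prod T d}
    (hu : ∀ n, IsMinimizer (onWeak (pathEnergy T D α μ (σ n) A ρ w₀ (x n) (g n))) (u n)) :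
    ∃ B, ∀ᶠ n in atTop, ‖(toWeakSpace ℝ (H1 T)).symm (u n).1‖ ≤ B ∧ (u n).2 ∈ A := by
  have hT := hS.T_pos
  have hD := hS.D_pos
  obtain ⟨p, hp⟩ := hS.nonempty
  have h0 : H1.rep (H1.interp hT 1 fun _ => w₀) 0 = w₀ := H1.rep_interp_zero hT one_pos _
  obtain ⟨U, a, -, hle, ha⟩ := hS.exists_recovery w₀ h0 hp
  obtain ⟨K, hK⟩ := ha.bddAbove_range
  obtain ⟨B, hB⟩ := hS.eventually_le_reducedData
  set S := 2 * D * (K - B) with hSdef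
  refine ⟨√(T * (2 * ‖w₀‖ ^ 2 + 2 * (T * S)) + S), ?_⟩
  filter_upwards [hB] with n hn
  set W : H1 T := (toWeakSpace ℝ (H1 T)).symm (u n).1 with hW
  have h1 : pathEnergy T D α μ (σ n) A ρ w₀ (x n) (g n) W (u n).2
      - (normalizationConstant T α (N n) (normalizedSignal T α μ (g n)) (σ n) : EReal)
        ≤ (K : EReal) :=
    (EReal.sub_le_sub (hu n (toWeakSpace ℝ (H1 T) (U n), p)) le_rfl).trans
      ((hle n).trans (EReal.coe_le_coe_iff.2 (hK (mem_range_self n))))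
  by_cases hadm : IsPiecewiseAffine T (N n) (H1.rep W) ∧ H1.rep W 0 = w₀ ∧ (u n).2 ∈ A
  · refine ⟨?_, hadm.2.2⟩
    rw [pathEnergy_sub_eq hT (hS.N_pos n) hadm.1 hadm.2.1 hadm.2.2, EReal.coe_le_coe_iff] at h1
    have h2 := hn W _ hadm.2.2
    have h3 : 1 / (2 * D) * H1.seminormSq W ≤ K - B := by linarith
    rw [one_div_mul_eq_div, div_le_iff₀ (by positivity), mul_comm] at h3
    refine Real.le_sqrt_of_sq_le ((H1.norm_sq_le hT W).trans ?_)
    rw [hadm.2.1]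
    gcongr
  · rw [pathEnergy_sub_eq_top hadm, top_le_iff] at h1
    exact absurd h1 (EReal.coe_ne_top K)

/-- Every subsequence of a sequence of minimizers has a convergent further subsequence. -/
theorem exists_subseq_tendsto (hS : IsReconstructionSetting T D α μ A ρ c M N x xlim σ g Q)
    {w₀ : Plane} {u : ℕ → WeakH1Prod T d}
    (hu : ∀ n, IsMinimizer (onWeak (pathEnergy T D α μ (σ n) A ρ w₀ (x n) (g n))) (u n))
    {φ : ℕ → ℕ} (hφ : StrictMono φ) :
    ∃ (ψ : ℕ → ℕ) (v : WeakH1Prod T d), StrictMono ψ ∧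
      Tendsto (fun k => u (φ (ψ k))) atTop (𝓝 v) := by
  obtain ⟨B, hB⟩ := hS.eventually_minimizer_bounded hu
  obtain ⟨n₀, hn₀⟩ := eventually_atTop.1 (hφ.tendsto_atTop.eventually hB)
  obtain ⟨W, χ, hχ, hW⟩ := exists_subseq_tendsto_weakly
    (u := fun k => (toWeakSpace ℝ (H1 T)).symm (u (φ (n₀ + k))).1)
    fun k => (hn₀ _ (Nat.le_add_right _ _)).1
  obtain ⟨p, -, κ, hκ, hp⟩ := hS.isCompact.tendsto_subseq
    (x := fun k => (u (φ (n₀ + χ k))).2) fun k => (hn₀ _ (Nat.le_add_right _ _)).2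
  refine ⟨fun k => n₀ + χ (κ k), (toWeakSpace ℝ (H1 T) W, p), ?_, ?_⟩
  · intro a b hab
    exact Nat.add_lt_add_left (hχ (hκ hab)) n₀
  · refine Tendsto.prodMk_nhds (tendsto_weakSpace_iff.2 fun f => ?_) hp
    exact (hW f).comp hκ.tendsto_atTop

end IsReconstructionSetting

/-- Uniform convergence of the scan paths gives pointwise convergence and a uniform bound of the
intensities. -/
theorem tendsto_and_bounded_intensity {T : ℝ} {N : ℕ → ℕ} {x : (n : ℕ) → Fin (N n) → Plane}
    {xlim : ℝ → Plane} (hxlim : ContinuousOn xlim (Icc 0 T))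
    (hx : TendstoUniformlyOn (fun n => scanPath T (x n)) xlim atTop (Ico 0 T))
    {ρtrue : Plane → ℝ} {w : ℝ → Plane} (hρ : Continuous ρtrue) (hw : ContinuousOn w (Icc 0 T)) :
    (∀ t ∈ Ico 0 T, Tendsto (fun n => ρtrue (scanPath T (x n) t + w t)) atTop
      (𝓝 (ρtrue (xlim t + w t)))) ∧
    ∃ L, ∀ᶠ n in atTop, ∀ t ∈ Ico 0 T, ρtrue (scanPath T (x n) t + w t) ≤ L := by
  refine ⟨fun t ht => (hρ.tendsto _).comp ((hx.tendsto_at ht).add_const _), ?_⟩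
  obtain ⟨B, hB⟩ := isCompact_Icc.exists_bound_of_continuousOn (hxlim.add hw)
  obtain ⟨L, hL⟩ := (isCompact_closedBall (0 : Plane) (B + 1)).exists_bound_of_continuousOn
    hρ.continuousOn
  refine ⟨L, ?_⟩
  filter_upwards [Metric.tendstoUniformlyOn_iff.1 hx 1 one_pos] with n hn t ht
  refine (le_abs_self _).trans (hL _ ?_)
  rw [mem_closedBall_zero_iff]
  have h1 := hn t ht
  rw [dist_comm, dist_eq_norm] at h1
  have h2 : ‖xlim t + w t‖ ≤ B := hB t (Ico_subset_Icc_self ht)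
  calc ‖scanPath T (x n) t + w t‖ = ‖(xlim t + w t) + (scanPath T (x n) t - xlim t)‖ := by
        congr 1; abel
    _ ≤ B + 1 := (norm_add_le _ _).trans (add_le_add h2 h1.le)

/-- The measured signals are almost surely regular. -/
theorem ae_exists_isRegularSignal {T α : ℝ} (hT : 0 < T) (hα : 0 < α) (μ : ℝ) {N : ℕ → ℕ}
    {x : (n : ℕ) → Fin (N n) → Plane} {xlim : ℝ → Plane} {σ : ℕ → ℝ}
    (hNlim : Tendsto N atTop atTop) (hxlim : ContinuousOn xlim (Icc 0 T))
    (hx : TendstoUniformlyOn (fun n => scanPath T (x n)) xlim atTop (Ico 0 T))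
    (hσ : ∀ n, 0 < σ n) (hσlim : Tendsto (fun n => σ n * N n / α) atTop (𝓝 0))
    {ρtrue : Plane → ℝ} {w : ℝ → Plane} (hρ : Continuous ρtrue) (hw : ContinuousOn w (Icc 0 T))
    {𝓞 : Type*} [MeasurableSpace 𝓞] {P : Measure 𝓞}
    {e : 𝓞 → PointConfig T} {R : ℝ → 𝓞 → ℝ} (he : IsUnitPoissonProcess P T e)
    (hR : IsGaussianWhiteNoise P T R) :
    ∀ᵐ ω ∂P, ∃ Q : Finset (ℝ × ℝ),
      electronMeasure (e ω) (fun t => ρtrue (xlim t + w t)) = ∑ q ∈ Q, Measure.dirac q.1 ∧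
      IsRegularSignal T α μ N σ
        (fun n => measuredSignal α μ (σ n) (N n) (e ω) (fun t => R t ω)
          (fun t => ρtrue (scanPath T (x n) t + w t))) Q := by
  obtain ⟨hlim, L, hL⟩ := tendsto_and_bounded_intensity hxlim hx hρ hw
  have hcont : ContinuousOn (fun t => ρtrue (xlim t + w t)) (Icc 0 T) :=
    hρ.comp_continuousOn (hxlim.add hw)
  set f : ℝ → ℝ := IccExtend hT.le ((Icc 0 T).domRestrict fun t => ρtrue (xlim t + w t)) with hf
  have hfm : Measurable f :=
    (continuousOn_iff_continuous_domRestrict.1 hcont).Icc_extend'.measurable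
  filter_upwards [he.ae_inter_eq_empty (measurableSet_eq_fun measurable_snd
      (hfm.comp measurable_fst)) (volume_graph_eq_zero hfm),
    he.ae_inter_eq_empty (measurableSet_eq_fun measurable_fst measurable_const)
      (volume_vertical_line_eq_zero T), hR.ae_eventually_le hT] with ω h1 h2 h3
  have hend : ∀ q ∈ (e ω).pts, q.1 ≠ T := fun q hq hqT => notMem_empty q (h2 ▸ ⟨hq, hqT⟩)
  have hgraph : ∀ q ∈ (e ω).pts, q.2 ≠ ρtrue (xlim q.1 + w q.1) := by
    intro q hq hq2
    have hmem := ((e ω).subset_strip hq).1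
    have : q.2 = f q.1 := by rw [hf, IccExtend_of_mem hT.le _ hmem, hq2]; rfl
    exact notMem_empty q (h1 ▸ ⟨hq, this⟩)
  obtain ⟨Q, hQ, hQe, hQn⟩ := exists_electronMeasure_eventually_eq hend hgraph hlim hL
  have hσle : ∀ᶠ n in atTop, σ n * N n ≤ α := by
    filter_upwards [hσlim.eventually_lt_const one_pos] with n hn
    rw [div_lt_one hα] at hn
    exact hn.le
  refine ⟨Q, hQe, hQ, ?_, hσ, hσle⟩
  filter_upwards [hQn, hσle, hNlim.eventually h3] with n a1 a2 a3
  refine ⟨fun i => R ((i + 1) * T / N n) ω, fun i => ?_, fun i => ?_⟩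
  · have := a3 i i.2
    rw [abs_mul, abs_of_pos (hσ n)]
    have h4 := mul_le_mul_of_nonneg_left this (hσ n).le
    linarith
  · classical
    rw [measuredSignal, a1, sum_dirac_real_eq_card Q measurableSet_Ico, pixelCount]

theorem theorem2 {T α : ℝ} (hT : 0 < T) (hα : 0 < α) :
    -- the constants depend only on the normalized signal and the noise level
    ∃ C : (N : ℕ) → (Fin N → ℝ) → ℝ → ℝ,
    -- the parametrized densities and the reconstruction parameters
    ∀ (d : ℕ) (A : Set (EuclideanSpace ℝ (Fin d))) (ρ : EuclideanSpace ℝ (Fin d) → Plane → ℝ)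
      (D μ : ℝ) (w₀ : Plane),
    IsCompact A → A.Nonempty → ContinuousIntoLipschitz A ρ →
    (∀ p ∈ A, ∃ c > 0, ∀ y, c ≤ ρ p y) → 0 < D →
    -- the scan paths and the noise levels
    ∀ (N : ℕ → ℕ) (x : (n : ℕ) → Fin (N n) → Plane) (xlim : ℝ → Plane) (σ : ℕ → ℝ),
    (∀ n, 0 < N n) → Tendsto N atTop atTop →
    ContinuousOn xlim (Icc 0 T) →
    TendstoUniformlyOn (fun n => scanPath T (x n)) xlim atTop (Ico 0 T) →
    (∀ n, 0 < σ n) → Tendsto (fun n => σ n * N n / α) atTop (𝓝 0) →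
    -- the true density and the realized sample motion
    ∀ (ρtrue : Plane → ℝ) (w : ℝ → Plane),
    Continuous ρtrue → (∀ y, 0 ≤ ρtrue y) → ContinuousOn w (Icc 0 T) →
    -- the random electron events and the random background noise
    ∀ (𝓞 : Type*) [MeasurableSpace 𝓞] (P : Measure 𝓞) [IsProbabilityMeasure P]
      (e : 𝓞 → PointConfig T) (R : ℝ → 𝓞 → ℝ),
    IsUnitPoissonProcess P T e → IsGaussianWhiteNoise P T R →
    ∀ᵐ ω ∂P,
      let g : (n : ℕ) → Fin (N n) → ℝ := fun n =>
        measuredSignal α μ (σ n) (N n) (e ω) (fun t => R t ω)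
          (fun t => ρtrue (scanPath T (x n) t + w t))
      let E : ℕ → WeakH1Prod T d → EReal := fun n =>
        onWeak (pathEnergy T D α μ (σ n) A ρ w₀ (x n) (g n))
      let Elim : WeakH1Prod T d → EReal :=
        onWeak (limitEnergy T D A ρ w₀ xlim
          (electronMeasure (e ω) (fun t => ρtrue (xlim t + w t))))
      -- Gamma-convergence up to the constants
      GammaConverges
        (fun n v => E n v - ((C (N n) (normalizedSignal T α μ (g n)) (σ n) : ℝ) : EReal)) Elim ∧
      -- every subsequence of a sequence of minimizers has a further subsequence that converges to
      -- a minimizer of the limit energy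
      ∀ u : ℕ → WeakH1Prod T d, (∀ n, IsMinimizer (E n) (u n)) →
        ∀ φ : ℕ → ℕ, StrictMono φ → ∃ (ψ : ℕ → ℕ) (v : WeakH1Prod T d),
          StrictMono ψ ∧ Tendsto (fun k => u (φ (ψ k))) atTop (𝓝 v) ∧ IsMinimizer Elim v := by
  refine ⟨normalizationConstant T α, ?_⟩
  intro d A ρ D μ w₀ hA hAne hρ hpos hD N x xlim σ hN hNlim hxlim hx hσ hσlim ρtrue w hρt _ hw
    𝓞 _ P _ e R he hR
  obtain ⟨c, hc, M, hbd⟩ := exists_uniform_density_bounds hA hρ hpos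
  filter_upwards [ae_exists_isRegularSignal hT hα μ hNlim hxlim hx hσ hσlim hρt hw he hR]
    with ω ⟨Q, hQ, hreg⟩
  intro g E Elim
  have hS : IsReconstructionSetting T D α μ A ρ c M N x xlim σ g Q :=
    { T_pos := hT
      D_pos := hD
      α_pos := hα
      isCompact := hA
      nonempty := hAne
      continuous := hρ
      c_pos := hc
      bounds := hbd
      N_pos := hN
      N_lim := hNlim
      path_lim := fun t ht => hx.tendsto_at ht
      signal := hreg }
  have hG := hS.gammaConverges w₀
  rw [← hQ] at hG
  refine ⟨hG, fun u hu φ hφ => ?_⟩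
  obtain ⟨ψ, v, hψ, hv⟩ := hS.exists_subseq_tendsto hu hφ
  exact ⟨ψ, v, hψ, hv, hG.isMinimizer_of_tendsto hu (hφ.comp hψ) hv⟩
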